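/- Let $\kappa:\mathbb R\to\mathbb R$ be continuous with limits $\kappa_\pm=\lim_{x\to\pm\infty}\kappa(x)$ satisfying $\kappa_+\kappa_-<0$, and assume $\kappa-\kappa_+\in L^1([0,\infty))$ and $\kappa-\kappa_-\in L^1((-\infty,0])$. Let $$\mathcal D=\tfrac32\bigl[-i\partial_x\sigma_1+\kappa(x)\sigma_2\bigr],\qquad \sigma_1=\begin{pmatrix}0&1\\1&0\end{pmatrix},\quad \sigma_2=\begin{pmatrix}0&-i\\ i&0\end{pmatrix},$$ be the Dirac operator on $L^2(\mathbb R;\mathbb C^2)$ with domain $H^1(\mathbb R;\mathbb C^2)$, and put $a=\tfrac32\min\{|\kappa_+|,|\kappa_-|\}$. For $e=(e_1,e_2)\in\mathbb C^2$ say that $\Psi:\mathbb R\to\mathbb C^2$ has *exponential decay with phases $e$* if there are real numbers $\lambda_-<0<\lambda_+$ and nonzero vectors $q_\pm\in\mathbb R^2$ with $$\lim_{x\to+\infty}e^{\lambda_+x}\Psi(x)=\operatorname{diag}(e)\,q_+,\qquad \lim_{x\to-\infty}e^{\lambda_-x}\Psi(x)=\operatorname{diag}(e)\,q_- .$$ Then: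 (a) The essential spectrum of $\mathcal D$ (the set of $z\in\mathbb C$ for which $\mathcal D-z$ is not a Fredholm operator) equals $(-\infty,-a]\cup[a,\infty)$. (b) $0$ is a simple eigenvalue of $\mathcal D$ (its eigenspace is one-dimensional). For every zero eigenfunction there is a constant $c\in\mathbb C\setminus\{0\}$ such that its continuous representative $\Psi$ has exponential decay with phases $(c,c)$. If moreover $\kappa\in C_b^\infty(\mathbb R)$ (that is, $\kappa$ is smooth and $\kappa$ and all its derivatives are bounded), then $\Psi$ is smooth, every derivative $\Psi^{(j)}$, $j\ge 0$, has exponential decay with phases $(c,c)$, and $\Psi\in H^s(\mathbb R;\mathbb C^2)$ for all $s\in\mathbb N$. (c) Every eigenvalue $E\in(-a,a)$ of $\mathcal D$ is simple. For every corresponding eigenfunction there is a constant $c\in\mathbb C\setminus\{0\}$ such that its continuous representative $\Psi$ has exponential decay with phases $(c\,e^{i\pi/4},c\,e^{-i\pi/4})$. If moreover $\kappa\in C_b^\infty(\mathbb R)$, then $\Psi$ is smooth, every derivative $\Psi^{(j)}$, $j\ge0$, has exponential decay with the same phases, and $\Psi\in H^s(\mathbb R;\mathbb C^2)$ for all $s\in\mathbb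 N$. -/

import Mathlib

open MeasureTheory Filter Topology Set
open scoped ContDiff SchwartzMap

noncomputable section

namespace DiracDomainWall

/-- The spinor space `ℂ²` with its Hermitian norm. -/
abbrev Spinor : Type := EuclideanSpace ℂ (Fin 2)

/-- The Hilbert space `L²(ℝ; ℂ²)`. -/
abbrev L2 : Type := Lp Spinor 2 (volume : Measure ℝ)

/-- An `L²` function viewed as a tempered distribution. -/
abbrev toDist (u : L2) : 𝓢'(ℝ, Spinor) := Lp.toTemperedDistribution u

/-- `w ∈ L²` is the distributional derivative of `u ∈ L²`. -/
def HasL2Deriv (u w : L2) : Prop :=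
  TemperedDistribution.derivCLM Spinor (toDist u) = toDist w

/-- The first Pauli matrix. -/
def pauli1 : Matrix (Fin 2) (Fin 2) ℂ := !![0, 1; 1, 0]

/-- The second Pauli matrix. -/
def pauli2 : Matrix (Fin 2) (Fin 2) ℂ := !![0, -Complex.I; Complex.I, 0]

/-- The pointwise expression `(3/2) (-i σ₁ w + k σ₂ u)`. -/
def diracSymbol (k : ℝ) (w u : Spinor) : Spinor :=
  (3 / 2 : ℂ) • (-Complex.I • Matrix.toEuclideanLin pauli1 w +
    (k : ℂ) • Matrix.toEuclideanLin pauli2 u)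

theorem diracSymbol_add (k : ℝ) (w w' u u' : Spinor) :
    diracSymbol k (w + w') (u + u') = diracSymbol k w u + diracSymbol k w' u' := by
  simp only [diracSymbol, map_add, smul_add]
  abel

theorem diracSymbol_smul (k : ℝ) (c : ℂ) (w u : Spinor) :
    diracSymbol k (c • w) (c • u) = c • diracSymbol k w u := by
  simp only [diracSymbol, map_smul, smul_add, smul_smul]
  congr 2 <;> ring

theorem hasL2Deriv_unique {u w w' : L2} (h : HasL2Deriv u w) (h' : HasL2Deriv u w') :
    w = w' := by
  have hk := Lp.ker_toTemperedDistributionCLM_eq_bot (E := ℝ) (F := Spinor)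
    (μ := volume) (p := 2)
  exact LinearMap.ker_eq_bot.mp hk (h.symm.trans h')

/-- The graph of the Dirac operator: all pairs `(u, v)` in `L² × L²` such that `u` has a
distributional derivative `w ∈ L²` and `v = (3/2) (-i σ₁ w + κ σ₂ u)` almost everywhere. -/
def diracGraph (κ : ℝ → ℝ) : Submodule ℂ (L2 × L2) where
  carrier := {p | ∃ w : L2, HasL2Deriv p.1 w ∧
    ∀ᵐ x, p.2 x = diracSymbol (κ x) (w x) (p.1 x)}
  zero_mem' := by
    refine ⟨0, ?_, ?_⟩
    · have h0 : toDist 0 = 0 := map_zero (Lp.toTemperedDistributionCLM Spinor volume 2)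
      simp [HasL2Deriv, h0]
    · filter_upwards [Lp.coeFn_zero Spinor 2 (volume : Measure ℝ)] with x hx
      change (0 : L2) x = diracSymbol (κ x) ((0 : L2) x) ((0 : L2) x)
      rw [hx]
      simp [diracSymbol]
  add_mem' := by
    rintro ⟨u, v⟩ ⟨u', v'⟩ ⟨w, hw, hv⟩ ⟨w', hw', hv'⟩
    refine ⟨w + w', ?_, ?_⟩
    · have ha : ∀ f g : L2, toDist (f + g) = toDist f + toDist g :=
        map_add (Lp.toTemperedDistributionCLM Spinor volume 2)
      simp only [HasL2Deriv] at hw hw' ⊢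
      simp only [Prod.mk_add_mk, ha, map_add, hw, hw']
    · filter_upwards [hv, hv', Lp.coeFn_add u u', Lp.coeFn_add v v', Lp.coeFn_add w w']
        with x h1 h2 h3 h4 h5
      simp only [Prod.mk_add_mk] at h1 h2 ⊢
      rw [h3, h4, h5]
      simp only [Pi.add_apply, h1, h2, diracSymbol_add]
  smul_mem' := by
    rintro c ⟨u, v⟩ ⟨w, hw, hv⟩
    refine ⟨c • w, ?_, ?_⟩
    · have hs : ∀ f : L2, toDist (c • f) = c • toDist f :=
        map_smul (Lp.toTemperedDistributionCLM Spinor volume 2) c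
      simp only [HasL2Deriv] at hw ⊢
      simp only [Prod.smul_mk, hs, map_smul, hw]
    · filter_upwards [hv, Lp.coeFn_smul c u, Lp.coeFn_smul c v, Lp.coeFn_smul c w]
        with x h1 h2 h3 h4
      simp only [Prod.smul_mk] at h1 ⊢
      rw [h2, h3, h4]
      simp only [Pi.smul_apply, h1, diracSymbol_smul]

/-- The Dirac operator `D = (3/2) (-i ∂ₓ σ₁ + κ(x) σ₂)` as an unbounded operator on
`L²(ℝ; ℂ²)`, with its natural domain (see `dirac_domain` for bounded `κ`). -/
def dirac (κ : ℝ → ℝ) : L2 →ₗ.[ℂ] L2 := (diracGraph κ).toLinearPMap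

/-- The graph relation is single valued, so it really is the graph of `dirac κ`. -/
theorem dirac_graph (κ : ℝ → ℝ) : (dirac κ).graph = diracGraph κ := by
  refine Submodule.toLinearPMap_graph_eq _ ?_
  rintro ⟨u, v⟩ ⟨w, hw, hv⟩ (rfl : u = 0)
  have hw0 : w = 0 := by
    refine hasL2Deriv_unique hw ?_
    have h0 : toDist 0 = 0 := map_zero (Lp.toTemperedDistributionCLM Spinor volume 2)
    simp [HasL2Deriv, h0]
  subst hw0
  change v = 0
  apply Lp.ext
  filter_upwards [hv, Lp.coeFn_zero Spinor 2 (volume : Measure ℝ)] with x h1 h2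
  rw [h1, h2]
  simp [diracSymbol]

/-- For bounded continuous `κ` the domain of the Dirac operator is
`H¹(ℝ; ℂ²) = {u ∈ L² | u' ∈ L²}`. -/
theorem dirac_domain {κ : ℝ → ℝ} (hκ : Continuous κ) {C : ℝ} (hC : ∀ x, |κ x| ≤ C) (u : L2) :
    u ∈ (dirac κ).domain ↔ ∃ w : L2, HasL2Deriv u w := by
  constructor
  · rintro ⟨⟨u', v⟩, ⟨w, hw, -⟩, rfl⟩
    exact ⟨w, hw⟩
  · rintro ⟨w, hw⟩
    have h1 : MemLp (fun x => -Complex.I • Matrix.toEuclideanLin pauli1 (w x)) 2 volume := by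
      have h : MemLp (fun x => Matrix.toEuclideanLin pauli1 (w x)) 2 volume :=
        (Matrix.toEuclideanLin pauli1).toContinuousLinearMap.comp_memLp' (Lp.memLp w)
      exact h.const_smul (-Complex.I)
    have h2 : MemLp (fun x => (κ x : ℂ) • Matrix.toEuclideanLin pauli2 (u x)) 2 volume := by
      have h : MemLp (fun x => Matrix.toEuclideanLin pauli2 (u x)) 2 volume :=
        (Matrix.toEuclideanLin pauli2).toContinuousLinearMap.comp_memLp' (Lp.memLp u)
      refine MemLp.of_le_mul (c := C) h ?_ ?_
      · exact (Complex.continuous_ofReal.comp hκ).aestronglyMeasurable.smul h.1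
      · filter_upwards with x
        rw [norm_smul, Complex.norm_real]
        exact mul_le_mul_of_nonneg_right (hC x) (norm_nonneg _)
    have h3 : MemLp (fun x => diracSymbol (κ x) (w x) (u x)) 2 volume :=
      (h1.add h2).const_smul (3 / 2 : ℂ)
    exact ⟨(u, h3.toLp _), ⟨w, hw, h3.coeFn_toLp⟩, rfl⟩

section Spectrum

variable {H : Type*} [NormedAddCommGroup H] [InnerProductSpace ℂ H]

/-- The operator `T - z`, defined on the domain of `T`. -/
def shift (T : H →ₗ.[ℂ] H) (z : ℂ) : T.domain →ₗ[ℂ] H := T.toFun - z • T.domain.subtype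

/-- The eigenspace `ker (T - z)`. -/
def eigenspace (T : H →ₗ.[ℂ] H) (z : ℂ) : Submodule ℂ T.domain := LinearMap.ker (shift T z)

/-- `z` is an eigenvalue of `T`: some nonzero `u` in the domain has `T u = z u`. -/
def IsEigenvalue (T : H →ₗ.[ℂ] H) (z : ℂ) : Prop := ∃ u : T.domain, u ≠ 0 ∧ T u = z • (u : H)

/-- `z` is a simple eigenvalue of `T`: its eigenspace is one-dimensional. -/
def IsSimpleEigenvalue (T : H →ₗ.[ℂ] H) (z : ℂ) : Prop :=
  Module.finrank ℂ (eigenspace T z) = 1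

/-- `T - z` is a Fredholm operator: finite-dimensional kernel, and closed range of finite
codimension. -/
def IsFredholmAt (T : H →ₗ.[ℂ] H) (z : ℂ) : Prop :=
  FiniteDimensional ℂ (eigenspace T z) ∧
  IsClosed (LinearMap.range (shift T z) : Set H) ∧
  FiniteDimensional ℂ (H ⧸ LinearMap.range (shift T z))

/-- The essential spectrum: all `z ∈ ℂ` for which `T - z` is not Fredholm. -/
def essentialSpectrum (T : H →ₗ.[ℂ] H) : Set ℂ := {z | ¬ IsFredholmAt T z}

end Spectrum

/-- `Ψ` has exponential decay with limiting directions in the real plane spanned by the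
phases `e`: for some `lm < 0 < lp`, the limits of `exp (lp x) Ψ(x)` at `+∞` and of
`exp (lm x) Ψ(x)` at `-∞` exist and have components `e i * qp i`, resp. `e i * qm i`, with
nonzero real vectors `qp`, `qm`. -/
def HasExpDecay (e : Fin 2 → ℂ) (Ψ : ℝ → Spinor) : Prop :=
  ∃ lm lp : ℝ, lm < 0 ∧ 0 < lp ∧ ∃ qm qp : Fin 2 → ℝ, qm ≠ 0 ∧ qp ≠ 0 ∧
    Tendsto (fun x => Real.exp (lp * x) • Ψ x) atTop
      (𝓝 (WithLp.toLp 2 fun i => e i * (qp i : ℂ))) ∧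
    Tendsto (fun x => Real.exp (lm * x) • Ψ x) atBot
      (𝓝 (WithLp.toLp 2 fun i => e i * (qm i : ℂ)))

/-- The space `C_b^∞(ℝ)`: smooth functions all of whose derivatives are bounded. -/
def IsCbInfty (κ : ℝ → ℝ) : Prop :=
  ContDiff ℝ ∞ κ ∧ ∀ k : ℕ, ∃ C : ℝ, ∀ x, |iteratedDeriv k κ x| ≤ C

/-- The decay and regularity properties of an eigenfunction `u`, with limiting directions
governed by the phases `e` up to the normalization `c ≠ 0` of the eigenfunction: the
continuous representative `Ψ` of `u` decays exponentially and, if `κ ∈ C_b^∞`, then `Ψ` is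
smooth, all its derivatives decay exponentially, and `u ∈ H^s` for every `s ∈ ℕ`. -/
def EigenfunctionDecay (κ : ℝ → ℝ) (e : Fin 2 → ℂ) (u : L2) : Prop :=
  ∃ (Ψ : ℝ → Spinor) (c : ℂ), Continuous Ψ ∧ (∀ᵐ x, u x = Ψ x) ∧ c ≠ 0 ∧
    HasExpDecay (fun i => c * e i) Ψ ∧
    (IsCbInfty κ → ContDiff ℝ ∞ Ψ ∧
      (∀ j : ℕ, HasExpDecay (fun i => c * e i) (iteratedDeriv j Ψ)) ∧
      ∀ s : ℕ, TemperedDistribution.MemSobolev (s : ℝ) 2 (toDist u))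

/-- The phases of the diagonal unitary `V = diag(e^{iπ/4}, e^{-iπ/4})`, which conjugates the
Dirac operator to an operator with real coefficients. -/
def realPhases : Fin 2 → ℂ :=
  ![Complex.exp (Complex.I * (Real.pi / 4)), Complex.exp (-(Complex.I * (Real.pi / 4)))]

end DiracDomainWall

end

/-
Writing the eigenvalue equation `D u = z u` in components gives the first-order system
`p' = κ p + b q`, `q' = b p - κ q` with `b = (2/3) i z`. Its Wronskian is constant, so two
square-integrable solutions are proportional and every eigenvalue is simple.

For `z` of modulus below both `(3/2)|κ₊|` and `(3/2)|κ₋|`, integrating the derivative of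
`η (|p|² - |q|²)`, where `η` has the same limits as `κ`, bounds `‖u‖` by a multiple of
`‖(D - z) u‖ + |u 0|`. As `D` is self-adjoint, this makes `D - z` Fredholm. For real `z` above one
of these thresholds, the constant-coefficient system at that end has bounded oscillating solutions,
and cutting them off yields Weyl sequences.

For real `z` multiplying the components by suitable phases makes the system real. Levinson's
argument (`κ - κ₊` is integrable) then shows that a decaying solution, rescaled by an exponential,
converges to a nonzero real vector. At `z = 0` the system decouples and `exp (± ∫₀ˣ κ)` is the zero
mode.
-/

noncomputable section

namespace DiracDomainWall

section Primitive

variable {E F : Type*} [NormedAddCommGroup E] [NormedAddCommGroup F]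

theorem intervalIntegrable_of_locallyIntegrable {f : ℝ → E} (hf : LocallyIntegrable f) (a b : ℝ) :
    IntervalIntegrable f volume a b :=
  (hf.integrableOn_isCompact isCompact_uIcc).intervalIntegrable

theorem locallyIntegrable_comp_neg {f : ℝ → E} (hf : LocallyIntegrable f) :
    LocallyIntegrable fun x => f (-x) := by
  refine fun x => ⟨Icc (x - 1) (x + 1), Icc_mem_nhds (by linarith) (by linarith), ?_⟩
  have h := hf.integrableOn_isCompact (isCompact_Icc (a := -(x + 1)) (b := -(x - 1)))
  simpa only [Set.neg_Icc, neg_neg] using h.comp_neg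

variable [NormedSpace ℝ E] [NormedSpace ℝ F]

/-- `U` is a primitive of the locally integrable function `u`, i.e. `U` is locally absolutely
continuous and `U' = u` almost everywhere. -/
structure IsPrimitive (U u : ℝ → E) : Prop where
  locallyIntegrable : LocallyIntegrable u
  eq_add_integral : ∀ x, U x = U 0 + ∫ t in (0 : ℝ)..x, u t

theorem absolutelyContinuousOnInterval_integral {f : ℝ → E} (hf : LocallyIntegrable f) (a b : ℝ) :
    AbsolutelyContinuousOnInterval (fun x => ∫ t in (0 : ℝ)..x, f t) a b := by
  let a' := min (min a b) 0
  let b' := max (max a b) 0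
  have hab : a' ≤ b' := (min_le_right _ _).trans (le_max_right _ _)
  have hint := intervalIntegrable_of_locallyIntegrable hf
  have hnorm (c d : ℝ) := (hint c d).norm
  have hac : AbsolutelyContinuousOnInterval (fun x => ∫ t in (0 : ℝ)..x, ‖f t‖) a' b' :=
    (hnorm a' b').absolutelyContinuousOnInterval_intervalIntegral
      (by rw [uIcc_of_le hab]; exact ⟨min_le_right _ _, le_max_right _ _⟩)
  have hdist (x y : ℝ) : dist (∫ t in (0 : ℝ)..x, f t) (∫ t in (0 : ℝ)..y, f t) ≤
      dist (∫ t in (0 : ℝ)..x, ‖f t‖) (∫ t in (0 : ℝ)..y, ‖f t‖) := by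
    rw [dist_eq_norm, Real.dist_eq,
      intervalIntegral.integral_interval_sub_left (hint _ _) (hint _ _),
      intervalIntegral.integral_interval_sub_left (hnorm _ _) (hnorm _ _)]
    exact intervalIntegral.norm_integral_le_abs_integral_norm
  have hac' : AbsolutelyContinuousOnInterval (fun x => ∫ t in (0 : ℝ)..x, f t) a' b' :=
    squeeze_zero (fun _ => Finset.sum_nonneg fun _ _ => dist_nonneg)
      (fun _ => Finset.sum_le_sum fun _ _ => hdist _ _) hac
  refine hac'.mono ?_
  rw [uIcc_of_le hab]
  exact Icc_subset_Icc (min_le_left _ _) (le_max_left _ _)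

namespace IsPrimitive

variable {U V u v : ℝ → E}

theorem eq_fun (h : IsPrimitive U u) : U = fun x => U 0 + ∫ t in (0 : ℝ)..x, u t :=
  funext h.eq_add_integral

theorem absolutelyContinuousOnInterval (h : IsPrimitive U u) (a b : ℝ) :
    AbsolutelyContinuousOnInterval U a b := by
  rw [h.eq_fun]
  exact (contDiff_const (c := U 0)).contDiffOn.absolutelyContinuousOnInterval.fun_add
    (absolutelyContinuousOnInterval_integral h.locallyIntegrable a b)

theorem continuous (h : IsPrimitive U u) : Continuous U := by
  rw [h.eq_fun]
  exact continuous_const.add (intervalIntegral.continuous_primitive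
    (intervalIntegrable_of_locallyIntegrable h.locallyIntegrable) 0)

theorem congr (h : IsPrimitive U u) (huv : u =ᵐ[volume] v) : IsPrimitive U v := by
  refine ⟨h.locallyIntegrable.congr huv, fun x => ?_⟩
  rw [h.eq_add_integral x]
  congr 1
  exact intervalIntegral.integral_congr_ae (huv.mono fun _ hx _ => hx)

theorem comp_neg (h : IsPrimitive U u) : IsPrimitive (fun x => U (-x)) (fun x => -u (-x)) := by
  refine ⟨(locallyIntegrable_comp_neg h.locallyIntegrable).neg, fun x => ?_⟩
  rw [h.eq_add_integral (-x), neg_zero, intervalIntegral.integral_neg,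
    intervalIntegral.integral_comp_neg (fun t => u t), intervalIntegral.integral_symm, neg_zero]

theorem tendsto_atTop (h : IsPrimitive U u) (hu : IntegrableOn u (Ioi 0)) :
    Tendsto U atTop (𝓝 (U 0 + ∫ x in Ioi 0, u x)) := by
  rw [h.eq_fun]
  simpa using (intervalIntegral_tendsto_integral_Ioi 0 hu tendsto_id).const_add (U 0)

theorem setIntegral_Ioi_eq (h : IsPrimitive U u) (hU : Integrable U)
    (hu : IntegrableOn u (Ioi 0)) : ∫ x in Ioi 0, u x = -U 0 := by
  refine eq_neg_of_add_eq_zero_right (IntegrableAtFilter.eq_zero_of_tendsto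
    ⟨univ, univ_mem, hU.integrableOn⟩ (fun s hs => ?_) (h.tendsto_atTop hu))
  obtain ⟨b, hb⟩ := mem_atTop_sets.1 hs
  exact measure_mono_top hb Real.volume_Ici

theorem add (h : IsPrimitive U u) (h' : IsPrimitive V v) :
    IsPrimitive (fun x => U x + V x) (fun x => u x + v x) := by
  refine ⟨h.locallyIntegrable.add h'.locallyIntegrable, fun x => ?_⟩
  rw [h.eq_add_integral x, h'.eq_add_integral x, intervalIntegral.integral_add
    (intervalIntegrable_of_locallyIntegrable h.locallyIntegrable _ _)
    (intervalIntegrable_of_locallyIntegrable h'.locallyIntegrable _ _)]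
  abel

theorem sub (h : IsPrimitive U u) (h' : IsPrimitive V v) :
    IsPrimitive (fun x => U x - V x) (fun x => u x - v x) := by
  refine ⟨h.locallyIntegrable.sub h'.locallyIntegrable, fun x => ?_⟩
  rw [h.eq_add_integral x, h'.eq_add_integral x, intervalIntegral.integral_sub
    (intervalIntegrable_of_locallyIntegrable h.locallyIntegrable _ _)
    (intervalIntegrable_of_locallyIntegrable h'.locallyIntegrable _ _)]
  abel

theorem integral_eq_zero (h : IsPrimitive U u) (hU : Integrable U) (hu : Integrable u) :
    ∫ x, u x = 0 := by
  have hneg := h.comp_neg.setIntegral_Ioi_eq hU.comp_neg hu.comp_neg.neg.integrableOn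
  rw [integral_neg, integral_comp_neg_Ioi, neg_zero] at hneg
  rw [← intervalIntegral.integral_Iic_add_Ioi hu.integrableOn hu.integrableOn,
    h.setIntegral_Ioi_eq hU hu.integrableOn, neg_injective hneg, add_neg_cancel]

variable [CompleteSpace E] [CompleteSpace F]

theorem ae_hasDerivAt (h : IsPrimitive U u) : ∀ᵐ x, HasDerivAt U (u x) x := by
  filter_upwards [LocallyIntegrable.ae_hasDerivAt_integral h.locallyIntegrable] with x hx
  rw [h.eq_fun]
  exact (hx 0).const_add _

theorem of_ae_hasDerivAt (hu : LocallyIntegrable u)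
    (hac : ∀ a b, AbsolutelyContinuousOnInterval U a b) (hd : ∀ᵐ x, HasDerivAt U (u x) x) :
    IsPrimitive U u := by
  refine ⟨hu, fun x => ?_⟩
  have hsub : AbsolutelyContinuousOnInterval (fun x => U x - ∫ t in (0 : ℝ)..x, u t) 0 x :=
    (hac 0 x).fun_sub (absolutelyContinuousOnInterval_integral hu 0 x)
  obtain ⟨C, hC⟩ := hsub.const_of_ae_hasDerivAt_zero (by
    filter_upwards [hd, LocallyIntegrable.ae_hasDerivAt_integral hu] with y hy hy' _
    exact sub_self (u y) ▸ hy.fun_sub (hy' 0))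
  have h0 := hC 0 left_mem_uIcc
  have hx := hC x right_mem_uIcc
  rw [intervalIntegral.integral_same, sub_zero] at h0
  rw [h0, ← hx, sub_add_cancel]

theorem of_hasDerivAt (hu : Continuous u) (hd : ∀ x, HasDerivAt U (u x) x) : IsPrimitive U u :=
  ⟨hu.locallyIntegrable, fun x => by
    rw [intervalIntegral.integral_eq_sub_of_hasDerivAt (fun y _ => hd y)
      (hu.intervalIntegrable 0 x), add_sub_cancel]⟩

theorem hasDerivAt (h : IsPrimitive U u) (hu : Continuous u) (x : ℝ) : HasDerivAt U (u x) x := by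
  rw [h.eq_fun]
  exact (intervalIntegral.integral_hasDerivAt_right (hu.intervalIntegrable 0 x)
    (hu.stronglyMeasurableAtFilter _ _) hu.continuousAt).const_add _

theorem clm_comp (h : IsPrimitive U u) (L : E →L[ℝ] F) :
    IsPrimitive (fun x => L (U x)) (fun x => L (u x)) where
  locallyIntegrable x := (h.locallyIntegrable x).imp fun _ hs => ⟨hs.1, L.integrable_comp hs.2⟩
  eq_add_integral x := by
    rw [h.eq_add_integral x, map_add, L.intervalIntegral_comp_comm
      (intervalIntegrable_of_locallyIntegrable h.locallyIntegrable _ _)]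

theorem smul {𝕜 : Type*} [RCLike 𝕜] [NormedSpace 𝕜 E] [IsScalarTower ℝ 𝕜 E] {f f' : ℝ → 𝕜}
    (hf : IsPrimitive f f') (h : IsPrimitive U u) :
    IsPrimitive (fun x => f x • U x) (fun x => f x • u x + f' x • U x) := by
  refine of_ae_hasDerivAt ?_ (fun a b => (hf.absolutelyContinuousOnInterval a b).fun_smul
    (h.absolutelyContinuousOnInterval a b)) ?_
  · rw [← locallyIntegrableOn_univ]
    have hu := h.locallyIntegrable.locallyIntegrableOn univ
    have hf' := hf.locallyIntegrable.locallyIntegrableOn univ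
    exact (hu.continuousOn_smul isOpen_univ.isLocallyClosed hf.continuous.continuousOn).add
      (hf'.smul_continuousOn isOpen_univ.isLocallyClosed h.continuous.continuousOn)
  · filter_upwards [hf.ae_hasDerivAt, h.ae_hasDerivAt] with x hf' hU'
    exact hf'.smul hU'

theorem conj_mul {p p' q q' : ℝ → ℂ} (hp : IsPrimitive p p') (hq : IsPrimitive q q') :
    IsPrimitive (fun x => starRingEnd ℂ (p x) * q x)
      (fun x => starRingEnd ℂ (p x) * q' x + starRingEnd ℂ (p' x) * q x) :=
  (hp.clm_comp Complex.conjCLE.toContinuousLinearMap).smul hq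

theorem norm_sq {p p' : ℝ → ℂ} (h : IsPrimitive p p') :
    IsPrimitive (fun x => ‖p x‖ ^ 2) (fun x => 2 * inner ℝ (p x) (p' x)) := by
  have hre := (h.conj_mul h).clm_comp Complex.reCLM
  simp only [Complex.reCLM_apply, Complex.conj_mul', Complex.add_re] at hre
  convert hre using 2 with x x
  · norm_cast
  · simp only [Complex.inner, Complex.mul_re, Complex.conj_re, Complex.conj_im]
    ring

theorem le_exp_mul_of_nonneg {n n' g : ℝ → ℝ} {K : ℝ} (h : IsPrimitive n n') (hK : 0 ≤ K)
    (hg : Integrable g) (hg0 : ∀ x, 0 ≤ g x) (hn : ∀ᵐ x, n' x ≤ K * n x + g x) {x : ℝ}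
    (hx : 0 ≤ x) : n x ≤ Real.exp (K * x) * (n 0 + ∫ t, g t) := by
  have hweight : IsPrimitive (fun x => Real.exp (-K * x)) (fun x => Real.exp (-K * x) * -K) :=
    of_hasDerivAt (by fun_prop) fun x => by simpa using ((hasDerivAt_id x).const_mul (-K)).exp
  have hm := hweight.smul h
  have hle : ∀ᵐ t, 0 ≤ t →
      Real.exp (-K * t) • n' t + (Real.exp (-K * t) * -K) • n t ≤ g t := by
    filter_upwards [hn] with t ht ht0
    have hexp : Real.exp (-K * t) ≤ 1 := Real.exp_le_one_iff.mpr (by nlinarith)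
    calc Real.exp (-K * t) • n' t + (Real.exp (-K * t) * -K) • n t
        = Real.exp (-K * t) * (n' t - K * n t) := by simp only [smul_eq_mul]; ring
      _ ≤ Real.exp (-K * t) * g t :=
        mul_le_mul_of_nonneg_left (by linarith) (Real.exp_nonneg _)
      _ ≤ g t := mul_le_of_le_one_left (hg0 t) hexp
  have hmx : Real.exp (-K * x) * n x ≤ n 0 + ∫ t, g t := by
    have heq := hm.eq_add_integral x
    simp only [smul_eq_mul, mul_zero, Real.exp_zero, one_mul] at heq hle
    rw [heq]
    refine add_le_add_right ((intervalIntegral.integral_mono_ae_restrict hx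
      (intervalIntegrable_of_locallyIntegrable hm.locallyIntegrable 0 x) hg.intervalIntegrable
      ((ae_restrict_iff' measurableSet_Icc).mpr (hle.mono fun t ht ht' => ht ht'.1))).trans ?_) _
    rw [intervalIntegral.integral_of_le hx]
    exact setIntegral_le_integral hg (.of_forall hg0)
  calc n x = Real.exp (K * x) * (Real.exp (-K * x) * n x) := by
        rw [← mul_assoc, ← Real.exp_add, neg_mul, add_neg_cancel, Real.exp_zero, one_mul]
    _ ≤ _ := mul_le_mul_of_nonneg_left hmx (Real.exp_nonneg _)

theorem le_exp_mul_abs {n n' g : ℝ → ℝ} {K : ℝ} (h : IsPrimitive n n') (hK : 0 ≤ K)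
    (hg : Integrable g) (hg0 : ∀ x, 0 ≤ g x) (hn : ∀ᵐ x, |n' x| ≤ K * n x + g x) (x : ℝ) :
    n x ≤ Real.exp (K * |x|) * (n 0 + ∫ t, g t) := by
  rcases le_total 0 x with hx | hx
  · rw [abs_of_nonneg hx]
    exact h.le_exp_mul_of_nonneg hK hg hg0 (hn.mono fun t ht => (le_abs_self _).trans ht) hx
  · have hneg : ∀ᵐ t, -n' (-t) ≤ K * n (-t) + g (-t) :=
      (Measure.measurePreserving_neg volume).quasiMeasurePreserving.ae
        (hn.mono fun t ht => (neg_le_abs _).trans ht)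
    have := h.comp_neg.le_exp_mul_of_nonneg hK hg.comp_neg (fun t => hg0 (-t)) hneg
      (neg_nonneg.mpr hx)
    rwa [neg_neg, neg_zero, integral_neg_eq_self, ← abs_of_nonpos hx] at this

end IsPrimitive

end Primitive

section DistributionalDerivative

theorem exists_contDiff_primitive_of_integral_eq_zero {h : ℝ → ℝ} (hh : ContDiff ℝ ∞ h)
    (hc : HasCompactSupport h) (hint : ∫ x, h x = 0) :
    ∃ Φ : ℝ → ℝ, ContDiff ℝ ∞ Φ ∧ HasCompactSupport Φ ∧ ∀ x, HasDerivAt Φ (h x) x := by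
  obtain ⟨R, hR⟩ := hc.isCompact.isBounded.subset_ball 0
  have hsupp {x : ℝ} (hx : h x ≠ 0) : |x| < R := by
    simpa using hR (subset_tsupport _ hx)
  let Φ : ℝ → ℝ := fun x => ∫ t in -R..x, h t
  have hderiv (x : ℝ) : HasDerivAt Φ (h x) x :=
    intervalIntegral.integral_hasDerivAt_right (hh.continuous.intervalIntegrable _ _)
      (hh.continuous.stronglyMeasurableAtFilter _ _) hh.continuous.continuousAt
  refine ⟨Φ, ?_, HasCompactSupport.of_support_subset_isCompact (isCompact_closedBall (0 : ℝ) R) ?_,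
    hderiv⟩
  · rw [contDiff_infty_iff_deriv, show deriv Φ = h from funext fun x => (hderiv x).deriv]
    exact ⟨fun x => (hderiv x).differentiableAt, hh⟩
  · intro x hx
    by_contra hxR
    rw [mem_closedBall_zero_iff, Real.norm_eq_abs, not_le] at hxR
    refine hx ?_
    rcases lt_abs.mp hxR with hxR | hxR
    · rw [← hint]
      refine intervalIntegral.integral_eq_integral_of_support_subset fun t ht => ?_
      exact ⟨(abs_lt.mp (hsupp ht)).1, ((abs_lt.mp (hsupp ht)).2.trans hxR).le⟩
    · refine intervalIntegral.integral_zero_ae (.of_forall fun t ht => ?_)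
      by_contra hne
      have := (abs_lt.mp (hsupp hne)).1
      rw [uIoc_of_ge (by linarith)] at ht
      exact absurd ht.2 (by linarith)

/-- The **du Bois-Reymond lemma**. -/
theorem ae_eq_const_of_integral_deriv_smul_eq_zero {E : Type*} [NormedAddCommGroup E]
    [NormedSpace ℝ E] [CompleteSpace E] {d : ℝ → E} (hd : LocallyIntegrable d)
    (h : ∀ g g' : ℝ → ℝ, ContDiff ℝ ∞ g → HasCompactSupport g → (∀ x, HasDerivAt g (g' x) x) →
      ∫ x, g' x • d x = 0) : ∃ c : E, ∀ᵐ x, d x = c := by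
  let bump : ContDiffBump (0 : ℝ) := ⟨1, 2, one_pos, one_lt_two⟩
  let χ : ℝ → ℝ := bump.normed volume
  have hχ : ContDiff ℝ ∞ χ := bump.contDiff_normed
  have hχc : HasCompactSupport χ := bump.hasCompactSupport_normed
  have hint {g : ℝ → ℝ} (hg : ContDiff ℝ ∞ g) (hgc : HasCompactSupport g) :
      Integrable fun x => g x • d x :=
    hd.integrable_smul_left_of_hasCompactSupport hg.continuous hgc
  refine ⟨∫ x, χ x • d x, ae_eq_of_integral_contDiff_smul_eq hd (locallyIntegrable_const _)
    fun g hg hgc => ?_⟩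
  have hzero : ∫ x, (g x - (∫ y, g y) * χ x) = 0 := by
    rw [integral_sub (hg.continuous.integrable_of_hasCompactSupport hgc)
      ((hχ.continuous.integrable_of_hasCompactSupport hχc).const_mul _),
      integral_const_mul, bump.integral_normed, mul_one, sub_self]
  obtain ⟨Φ, hΦ, hΦc, hΦ'⟩ := exists_contDiff_primitive_of_integral_eq_zero
    (hg.sub (contDiff_const.mul hχ)) (hgc.sub hχc.mul_left) hzero
  have hd0 := h Φ _ hΦ hΦc hΦ'
  simp only [sub_smul, mul_smul] at hd0
  rw [integral_sub (hint hg hgc) ((hint hχ hχc).fun_smul _), integral_smul, sub_eq_zero] at hd0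
  rw [hd0, integral_smul_const]

theorem integral_deriv_smul_eq {u w : L2} (h : HasL2Deriv u w) {g g' : ℝ → ℝ}
    (hg : ContDiff ℝ ∞ g) (hc : HasCompactSupport g) (hg' : ∀ x, HasDerivAt g (g' x) x) :
    ∫ x, g' x • u x = -∫ x, g x • w x := by
  have hgℂ : ContDiff ℝ ∞ fun x => (g x : ℂ) := Complex.ofRealCLM.contDiff.comp hg
  have hcℂ : HasCompactSupport fun x => (g x : ℂ) :=
    hc.comp_left (g := fun y : ℝ => (y : ℂ)) Complex.ofReal_zero
  let φ : 𝓢(ℝ, ℂ) := hcℂ.toSchwartzMap hgℂ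
  have hφ (x : ℝ) : φ x = g x := rfl
  have hφ' (x : ℝ) : SchwartzMap.derivCLM ℂ ℂ φ x = g' x := (hg' x).ofReal_comp.deriv
  have heq := congrArg (fun T => T φ) h
  simp only [TemperedDistribution.derivCLM_apply_apply, map_neg, Lp.toTemperedDistribution_apply,
    hφ, hφ', Complex.coe_smul] at heq
  rw [← heq, neg_neg]

theorem exists_isPrimitive {u w : L2} (h : HasL2Deriv u w) :
    ∃ U : ℝ → Spinor, IsPrimitive U w ∧ u =ᵐ[volume] U := by
  have hw : LocallyIntegrable w := (Lp.memLp w).locallyIntegrable (by norm_num)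
  have hu : LocallyIntegrable u := (Lp.memLp u).locallyIntegrable (by norm_num)
  let W : ℝ → Spinor := fun x => ∫ t in (0 : ℝ)..x, w t
  have hW : IsPrimitive W w := ⟨hw, fun x => by simp [W]⟩
  have hWl : LocallyIntegrable W := hW.continuous.locallyIntegrable
  obtain ⟨c, hc⟩ := ae_eq_const_of_integral_deriv_smul_eq_zero (hu.sub hWl) <| by
    intro g g' hg hgc hg'
    have hg'_eq : g' = deriv g := funext fun x => (hg' x).deriv.symm
    have hg'c : Continuous g' := hg'_eq ▸ hg.continuous_deriv (by simp)
    have hg's : HasCompactSupport g' := hg'_eq ▸ hgc.deriv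
    have hint {f : ℝ → Spinor} (hf : LocallyIntegrable f) : Integrable fun x => g x • f x :=
      hf.integrable_smul_left_of_hasCompactSupport hg.continuous hgc
    have hint' {f : ℝ → Spinor} (hf : LocallyIntegrable f) : Integrable fun x => g' x • f x :=
      hf.integrable_smul_left_of_hasCompactSupport hg'c hg's
    have hparts := ((IsPrimitive.of_hasDerivAt hg'c hg').smul hW).integral_eq_zero (hint hWl)
      ((hint hw).add (hint' hWl))
    rw [integral_add (hint hw) (hint' hWl)] at hparts
    simp only [Pi.sub_apply, smul_sub]
    rw [integral_sub (hint' hu) (hint' hWl), integral_deriv_smul_eq h hg hgc hg',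
      eq_neg_of_add_eq_zero_right hparts, sub_self]
  refine ⟨fun x => W x + c, ⟨hw, fun x => by simp [W, add_comm]⟩, hc.mono fun x hx => ?_⟩
  rw [← hx, Pi.sub_apply]
  exact (add_sub_cancel (W x) (u x)).symm

theorem integrable_schwartz_smul (ψ : 𝓢(ℝ, ℂ)) (f : L2) : Integrable fun x => ψ x • f x :=
  memLp_one_iff_integrable.mp (MemLp.smul (p := 2) (q := 2) (r := 1) (Lp.memLp f) (ψ.memLp 2))

theorem hasL2Deriv_of_isPrimitive {u w : L2} {U : ℝ → Spinor} (h : IsPrimitive U w)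
    (hu : u =ᵐ[volume] U) : HasL2Deriv u w := by
  ext φ : 1
  have hφ : IsPrimitive φ (SchwartzMap.derivCLM ℂ ℂ φ) :=
    .of_hasDerivAt (SchwartzMap.derivCLM ℂ ℂ φ).continuous φ.hasDerivAt
  have hint := integrable_schwartz_smul
  have hu_smul (ψ : 𝓢(ℝ, ℂ)) : (fun x => ψ x • u x) =ᵐ[volume] fun x => ψ x • U x :=
    hu.mono fun x hx => congrArg (ψ x • ·) hx
  have hintU (ψ : 𝓢(ℝ, ℂ)) : Integrable fun x => ψ x • U x := (hint ψ u).congr (hu_smul ψ)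
  have hparts := (hφ.smul h).integral_eq_zero (hintU φ)
    ((hint φ w).add (hintU (SchwartzMap.derivCLM ℂ ℂ φ)))
  rw [integral_add (hint φ w) (hintU _)] at hparts
  rw [TemperedDistribution.derivCLM_apply_apply, map_neg, Lp.toTemperedDistribution_apply,
    Lp.toTemperedDistribution_apply, eq_neg_of_add_eq_zero_left hparts,
    integral_congr_ae (hu_smul _)]

end DistributionalDerivative

section Sobolev

open TemperedDistribution

theorem toDist_add_smul (u v : L2) (c : ℂ) : toDist (u + c • v) = toDist u + c • toDist v := by
  have hadd : ∀ f g : L2, toDist (f + g) = toDist f + toDist g :=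
    map_add (Lp.toTemperedDistributionCLM Spinor volume 2)
  have hsmul : ∀ f : L2, toDist (c • f) = c • toDist f :=
    map_smul (Lp.toTemperedDistributionCLM Spinor volume 2) c
  rw [hadd, hsmul]

theorem hasL2Deriv_add_smul {u w u' w' : L2} (h : HasL2Deriv u w) (h' : HasL2Deriv u' w') (c : ℂ) :
    HasL2Deriv (u + c • u') (w + c • w') := by
  unfold HasL2Deriv at h h' ⊢
  rw [toDist_add_smul, toDist_add_smul, map_add, map_smul, h, h']

variable {F : Type*} [NormedAddCommGroup F] [NormedSpace ℂ F]

theorem laplacian_eq_derivCLM_derivCLM (f : 𝓢'(ℝ, F)) :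
    Laplacian.laplacian f = derivCLM F (derivCLM F f) := by
  have hderiv (g : 𝓢'(ℝ, F)) : LineDeriv.lineDerivOp (1 : ℝ) g = derivCLM F g := by
    ext φ : 1
    rw [lineDerivOp_apply_apply, derivCLM_apply_apply]
    congr 2
  simpa [hderiv] using laplacian_eq_sum (OrthonormalBasis.singleton (Fin 1) ℝ) f

theorem besselPotential_two_apply (f : 𝓢'(ℝ, F)) :
    besselPotential ℝ F 2 f = f + (-((2 * Real.pi : ℂ) ^ 2)⁻¹) • derivCLM F (derivCLM F f) := by
  have hsymbol : (fun x : ℝ => (((1 + ‖x‖ ^ 2) ^ ((2 : ℝ) / 2) : ℝ) : ℂ)) =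
      (fun _ => 1) + fun x => ((‖x‖ ^ 2 : ℝ) : ℂ) := by
    ext x; simp
  have hsplit : fourierMultiplierCLM F
        ((fun _ : ℝ => (1 : ℂ)) + fun x => ((‖x‖ ^ 2 : ℝ) : ℂ)) f =
      f + fourierMultiplierCLM F (fun x : ℝ => ((‖x‖ ^ 2 : ℝ) : ℂ)) f := by
    rw [fourierMultiplierCLM_apply, fourierMultiplierCLM_apply, smulLeftCLM_add (by fun_prop)
      (by fun_prop), _root_.add_apply, smulLeftCLM_const, one_smul,
      FourierTransform.fourierInv_add, FourierTransform.fourierInv_fourier_eq]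
  rw [← laplacian_eq_derivCLM_derivCLM, laplacian_eq_fourierMultiplierCLM, besselPotential,
    hsymbol, hsplit, ← Complex.coe_smul, smul_smul]
  congr 1
  have hπ : (Real.pi : ℂ) ≠ 0 := by exact_mod_cast Real.pi_ne_zero
  push_cast
  rw [neg_mul_neg, inv_mul_cancel₀ (by simp [hπ]), one_smul]

theorem memSobolev_two_mul {D : ℕ → L2} (h : ∀ j, HasL2Deriv (D j) (D (j + 1))) (m : ℕ) :
    MemSobolev (2 * m : ℝ) 2 (toDist (D 0)) := by
  induction m generalizing D with
  | zero =>
    rw [Nat.cast_zero, mul_zero, memSobolev_zero_iff]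
    exact ⟨D 0, rfl⟩
  | succ m ih =>
    let c : ℂ := -((2 * Real.pi : ℂ) ^ 2)⁻¹
    have hmem := ih (D := fun j => D j + c • D (j + 2)) fun j =>
      hasL2Deriv_add_smul (h j) (h (j + 2)) c
    have hbessel : toDist (D 0 + c • D 2) = besselPotential ℝ Spinor 2 (toDist (D 0)) := by
      have h0 : derivCLM Spinor (toDist (D 0)) = toDist (D 1) := h 0
      have h1 : derivCLM Spinor (toDist (D 1)) = toDist (D 2) := h 1
      rw [besselPotential_two_apply, h0, h1, toDist_add_smul]
    rw [zero_add, hbessel, memSobolev_besselPotential_iff] at hmem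
    convert hmem using 1
    push_cast
    ring

theorem memSobolev_of_hasL2Deriv {D : ℕ → L2} (h : ∀ j, HasL2Deriv (D j) (D (j + 1))) (s : ℕ) :
    MemSobolev (s : ℝ) 2 (toDist (D 0)) :=
  (memSobolev_two_mul h s).mono (by linarith [Nat.cast_nonneg (α := ℝ) s])

end Sobolev

section FirstOrderSystem

variable {𝕜 : Type*} [RCLike 𝕜] {κ : ℝ → ℝ} {b c : 𝕜} {p q p' q' : ℝ → 𝕜}

/-- The first-order system `p' = κ p + b q`, `q' = c p - κ q`, to which the eigenvalue equation of
the Dirac operator reduces. -/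
structure IsSol (κ : ℝ → ℝ) (b c : 𝕜) (p q : ℝ → 𝕜) : Prop where
  fst : ∀ x, HasDerivAt p (κ x • p x + b * q x) x
  snd : ∀ x, HasDerivAt q (c * p x - κ x • q x) x

namespace IsSol

theorem continuous_fst (h : IsSol κ b c p q) : Continuous p :=
  continuous_iff_continuousAt.mpr fun x => (h.fst x).continuousAt

theorem continuous_snd (h : IsSol κ b c p q) : Continuous q :=
  continuous_iff_continuousAt.mpr fun x => (h.snd x).continuousAt

theorem sub_const_mul (h : IsSol κ b c p q) (h' : IsSol κ b c p' q') (t : 𝕜) :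
    IsSol κ b c (fun x => p x - t * p' x) (fun x => q x - t * q' x) where
  fst x := ((h.fst x).fun_sub ((h'.fst x).const_mul t)).congr_deriv (by
    rw [smul_sub, mul_add, mul_smul_comm]; ring)
  snd x := ((h.snd x).fun_sub ((h'.snd x).const_mul t)).congr_deriv (by
    rw [smul_sub, mul_sub, mul_smul_comm]; ring)

theorem comp_neg (h : IsSol κ b c p q) :
    IsSol (fun x => -κ (-x)) (-b) (-c) (fun x => p (-x)) (fun x => q (-x)) where
  fst x := ((h.fst (-x)).scomp x (hasDerivAt_neg x)).congr_deriv (by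
    simp only [neg_smul, one_smul]; ring)
  snd x := ((h.snd (-x)).scomp x (hasDerivAt_neg x)).congr_deriv (by
    simp only [neg_smul, one_smul]; ring)

theorem wronskian_eq (h : IsSol κ b c p q) (h' : IsSol κ b c p' q') (x : ℝ) :
    p x * q' x - q x * p' x = p 0 * q' 0 - q 0 * p' 0 := by
  have hd (y : ℝ) : HasDerivAt (fun y => p y * q' y - q y * p' y) 0 y := by
    refine (((h.fst y).fun_mul (h'.snd y)).fun_sub ((h.snd y).fun_mul (h'.fst y))).congr_deriv ?_
    simp only [RCLike.real_smul_eq_coe_mul]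
    ring
  exact is_const_of_deriv_eq_zero (fun y => (hd y).differentiableAt) (fun y => (hd y).deriv) x 0

variable {L : ℝ}

theorem eq_zero (h : IsSol κ b c p q) (hL : ∀ x, |κ x| ≤ L) {a : ℝ} (hp : p a = 0)
    (hq : q a = 0) (x : ℝ) : p x = 0 ∧ q x = 0 := by
  let field : ℝ → 𝕜 × 𝕜 → 𝕜 × 𝕜 := fun t y => (κ t • y.1 + b * y.2, c * y.1 - κ t • y.2)
  have hL0 : 0 ≤ L := (abs_nonneg _).trans (hL 0)
  have hlip (t : ℝ) : LipschitzWith (L + ‖b‖ + ‖c‖).toNNReal (field t) := by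
    refine LipschitzWith.of_dist_le_mul fun y y' => ?_
    rw [Real.coe_toNNReal _ (by positivity), dist_eq_norm, dist_eq_norm]
    have hfst := norm_fst_le (y - y')
    have hsnd := norm_snd_le (y - y')
    have hκ {z : 𝕜} (hz : ‖z‖ ≤ ‖y - y'‖) : ‖κ t • z‖ ≤ L * ‖y - y'‖ := by
      rw [norm_smul, Real.norm_eq_abs]
      exact mul_le_mul (hL t) hz (norm_nonneg _) hL0
    have hmul (a : 𝕜) {z : 𝕜} (hz : ‖z‖ ≤ ‖y - y'‖) : ‖a * z‖ ≤ ‖a‖ * ‖y - y'‖ := by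
      rw [norm_mul]
      exact mul_le_mul_of_nonneg_left hz (norm_nonneg _)
    have hb : 0 ≤ ‖b‖ * ‖y - y'‖ := by positivity
    have hc : 0 ≤ ‖c‖ * ‖y - y'‖ := by positivity
    have hfield : field t y - field t y' =
        (κ t • (y - y').1 + b * (y - y').2, c * (y - y').1 - κ t • (y - y').2) := by
      ext <;> simp only [field, Prod.fst_sub, Prod.snd_sub, smul_sub] <;> ring
    rw [hfield]
    refine max_le ((norm_add_le _ _).trans ?_) ((norm_sub_le _ _).trans ?_)
    · linarith [hκ hfst, hmul b hsnd]
    · linarith [hκ hsnd, hmul c hfst]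
  have heq := ODE_solution_unique_univ (v := field) (s := fun _ => univ) (t₀ := a)
    (f := fun t => (p t, q t)) (g := fun _ => 0) (fun t => (hlip t).lipschitzOnWith)
    (fun t => ⟨(h.fst t).prodMk (h.snd t), trivial⟩)
    (fun t => ⟨(hasDerivAt_const t 0).congr_deriv (by ext <;> simp [field]), trivial⟩)
    (Prod.ext hp hq)
  exact Prod.mk_inj.mp (congrFun heq x)

theorem exists_eq_mul (hL : ∀ x, |κ x| ≤ L) (h : IsSol κ b c p q) (h' : IsSol κ b c p' q')
    (h0 : p 0 ≠ 0 ∨ q 0 ≠ 0) (hW : p 0 * q' 0 - q 0 * p' 0 = 0) :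
    ∃ t : 𝕜, ∀ x, p' x = t * p x ∧ q' x = t * q x := by
  obtain ⟨t, hp, hq⟩ : ∃ t : 𝕜, p' 0 = t * p 0 ∧ q' 0 = t * q 0 := by
    rcases h0 with h0 | h0
    · refine ⟨p' 0 / p 0, by field_simp, ?_⟩
      field_simp
      linear_combination hW
    · refine ⟨q' 0 / q 0, ?_, by field_simp⟩
      field_simp
      linear_combination -hW
  refine ⟨t, fun x => ?_⟩
  have hzero := (h'.sub_const_mul h t).eq_zero hL (sub_eq_zero.mpr hp) (sub_eq_zero.mpr hq) x
  exact hzero.imp sub_eq_zero.mp sub_eq_zero.mp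

theorem exists_eq_mul_of_memLp (hL : ∀ x, |κ x| ≤ L) (h : IsSol κ b c p q)
    (h' : IsSol κ b c p' q') (h0 : p 0 ≠ 0 ∨ q 0 ≠ 0) (hp : MemLp p 2) (hq : MemLp q 2)
    (hp' : MemLp p' 2) (hq' : MemLp q' 2) : ∃ t : 𝕜, ∀ x, p' x = t * p x ∧ q' x = t * q x := by
  refine h.exists_eq_mul hL h' h0 ?_
  have hint : Integrable fun x => p x * q' x - q x * p' x :=
    (hp.integrable_mul hq').sub (hq.integrable_mul hp')
  simp only [h.wronskian_eq h'] at hint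
  simpa [integrable_const_iff, isFiniteMeasure_iff] using hint

theorem re {b c : ℝ} {p q : ℝ → ℂ} (h : IsSol κ (b : ℂ) c p q) :
    IsSol κ b c (fun x => (p x).re) (fun x => (q x).re) where
  fst x := (Complex.reCLM.hasFDerivAt.comp_hasDerivAt x (h.fst x)).congr_deriv (by simp)
  snd x := (Complex.reCLM.hasFDerivAt.comp_hasDerivAt x (h.snd x)).congr_deriv (by simp)

theorem im {b c : ℝ} {p q : ℝ → ℂ} (h : IsSol κ (b : ℂ) c p q) :
    IsSol κ b c (fun x => (p x).im) (fun x => (q x).im) where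
  fst x := (Complex.imCLM.hasFDerivAt.comp_hasDerivAt x (h.fst x)).congr_deriv (by simp)
  snd x := (Complex.imCLM.hasFDerivAt.comp_hasDerivAt x (h.snd x)).congr_deriv (by simp)

theorem ofReal {b c : ℝ} {p q : ℝ → ℝ} (h : IsSol κ b c p q) :
    IsSol κ (b : ℂ) c (fun x => (p x : ℂ)) (fun x => (q x : ℂ)) where
  fst x := (h.fst x).ofReal_comp.congr_deriv (by simp)
  snd x := (h.snd x).ofReal_comp.congr_deriv (by simp)

theorem exists_real_of_memLp {b c : ℝ} {p q : ℝ → ℂ} (hL : ∀ x, |κ x| ≤ L)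
    (h : IsSol κ (b : ℂ) c p q) (hp : MemLp p 2) (hq : MemLp q 2) (h0 : p 0 ≠ 0 ∨ q 0 ≠ 0) :
    ∃ (P Q : ℝ → ℝ) (t : ℂ), IsSol κ b c P Q ∧ (P 0 ≠ 0 ∨ Q 0 ≠ 0) ∧ MemLp P 2 ∧ MemLp Q 2 ∧
      t ≠ 0 ∧ ∀ x, p x = t * P x ∧ q x = t * Q x := by
  obtain ⟨P, Q, hPQ, hPQ0, hP, hQ⟩ : ∃ P Q : ℝ → ℝ, IsSol κ b c P Q ∧ (P 0 ≠ 0 ∨ Q 0 ≠ 0) ∧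
      MemLp P 2 ∧ MemLp Q 2 := by
    by_cases hre : (p 0).re ≠ 0 ∨ (q 0).re ≠ 0
    · exact ⟨_, _, h.re, hre, hp.re, hq.re⟩
    · push Not at hre
      refine ⟨_, _, h.im, h0.imp (fun hp0 him => hp0 (Complex.ext hre.1 him))
        (fun hq0 him => hq0 (Complex.ext hre.2 him)), hp.im, hq.im⟩
  obtain ⟨t, ht⟩ := hPQ.ofReal.exists_eq_mul_of_memLp hL h
    (by simpa only [ne_eq, Complex.ofReal_eq_zero] using hPQ0) hP.ofReal hQ.ofReal hp hq
  refine ⟨P, Q, t, hPQ, hPQ0, hP, hQ, ?_, ht⟩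
  rintro rfl
  simp [ht 0] at h0

end IsSol

end FirstOrderSystem

section Graph

/-- The spinor field with components `P` and `Q`. -/
def spinor (P Q : ℝ → ℂ) (x : ℝ) : Spinor := WithLp.toLp 2 ![P x, Q x]

theorem eq_spinor (u : ℝ → Spinor) : u = spinor (fun x => u x 0) (fun x => u x 1) := by
  ext x i
  fin_cases i <;> rfl

theorem memLp_spinor {P Q : ℝ → ℂ} (hP : MemLp P 2) (hQ : MemLp Q 2) : MemLp (spinor P Q) 2 :=
  MemLp.of_eval_piLp fun i => by fin_cases i <;> assumption

theorem continuous_spinor {P Q : ℝ → ℂ} (hP : Continuous P) (hQ : Continuous Q) :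
    Continuous (spinor P Q) :=
  (PiLp.continuous_toLp 2 _).comp (continuous_pi fun i => by fin_cases i <;> assumption)

theorem IsPrimitive.coord {U u : ℝ → Spinor} (h : IsPrimitive U u) (i : Fin 2) :
    IsPrimitive (fun x => U x i) (fun x => u x i) :=
  h.clm_comp ((EuclideanSpace.proj i : Spinor →L[ℂ] ℂ).restrictScalars ℝ)

/-- The derivative `w` determined by the values `u` and `v = (3/2) (-i σ₁ w + k σ₂ u)`. -/
def derivSymbol (k : ℝ) (u v : Spinor) : Spinor :=
  WithLp.toLp 2 ![k * u 0 + 2 / 3 * Complex.I * v 1, -(k * u 1) + 2 / 3 * Complex.I * v 0]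

theorem diracSymbol_apply_zero (k : ℝ) (w u : Spinor) :
    diracSymbol k w u 0 = -(3 / 2) * Complex.I * (w 1 + k * u 1) := by
  simp [diracSymbol, pauli1, pauli2, Matrix.toLpLin_apply, Matrix.vecHead, Matrix.vecTail]
  ring

theorem diracSymbol_apply_one (k : ℝ) (w u : Spinor) :
    diracSymbol k w u 1 = -(3 / 2) * Complex.I * (w 0 - k * u 0) := by
  simp [diracSymbol, pauli1, pauli2, Matrix.toLpLin_apply, Matrix.vecHead, Matrix.vecTail]
  ring

theorem eq_diracSymbol_iff (k : ℝ) (u v w : Spinor) :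
    v = diracSymbol k w u ↔ w = derivSymbol k u v := by
  constructor
  · rintro rfl
    ext i
    fin_cases i <;>
      simp only [derivSymbol, diracSymbol_apply_zero, diracSymbol_apply_one, Fin.zero_eta,
        Fin.mk_one, Matrix.cons_val_zero, Matrix.cons_val_one]
    · linear_combination (w 0 - k * u 0) * Complex.I_sq
    · linear_combination (w 1 + k * u 1) * Complex.I_sq
  · rintro rfl
    ext i
    fin_cases i <;>
      simp only [derivSymbol, diracSymbol_apply_zero, diracSymbol_apply_one, Fin.zero_eta,
        Fin.mk_one, Matrix.cons_val_zero, Matrix.cons_val_one]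
    · linear_combination v 0 * Complex.I_sq
    · linear_combination v 1 * Complex.I_sq

variable {κ : ℝ → ℝ} {L : ℝ}

theorem exists_isPrimitive_of_mem_diracGraph {u v : L2} (h : (u, v) ∈ diracGraph κ) :
    ∃ U : ℝ → Spinor, IsPrimitive U (fun x => derivSymbol (κ x) (U x) (v x)) ∧
      u =ᵐ[volume] U := by
  obtain ⟨w, hw, hv⟩ := h
  obtain ⟨U, hU, huU⟩ := exists_isPrimitive hw
  refine ⟨U, hU.congr ?_, huU⟩
  filter_upwards [hv, huU] with x hx hx'
  rw [← hx', ← eq_diracSymbol_iff]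
  exact hx

theorem memLp_ofReal_mul (hκ : Continuous κ) (hL : ∀ x, |κ x| ≤ L) {P : ℝ → ℂ}
    (hP : MemLp P 2) : MemLp (fun x => κ x * P x) 2 := by
  refine MemLp.of_le_mul (c := L) hP
    ((Complex.continuous_ofReal.comp hκ).aestronglyMeasurable.mul hP.1) (ae_of_all _ fun x => ?_)
  rw [norm_mul, Complex.norm_real]
  exact mul_le_mul_of_nonneg_right (hL x) (norm_nonneg _)

theorem memLp_derivSymbol (hκ : Continuous κ) (hL : ∀ x, |κ x| ≤ L) {u v : ℝ → Spinor}
    (hu : MemLp u 2) (hv : MemLp v 2) : MemLp (fun x => derivSymbol (κ x) (u x) (v x)) 2 :=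
  memLp_spinor ((memLp_ofReal_mul hκ hL (hu.eval_piLp 0)).add
    ((hv.eval_piLp 1).const_mul (2 / 3 * Complex.I)))
    ((memLp_ofReal_mul hκ hL (hu.eval_piLp 1)).neg.add
      ((hv.eval_piLp 0).const_mul (2 / 3 * Complex.I)))

theorem mem_diracGraph_of_isPrimitive (hκ : Continuous κ) (hL : ∀ x, |κ x| ≤ L) {u v : L2}
    {U : ℝ → Spinor} (hU : IsPrimitive U (fun x => derivSymbol (κ x) (U x) (v x)))
    (hu : u =ᵐ[volume] U) : (u, v) ∈ diracGraph κ := by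
  have hmem : MemLp U 2 := (memLp_congr_ae hu).mp (Lp.memLp u)
  have hw := memLp_derivSymbol hκ hL hmem (Lp.memLp v)
  refine ⟨hw.toLp _, hasL2Deriv_of_isPrimitive (hU.congr hw.coeFn_toLp.symm) hu, ?_⟩
  filter_upwards [hw.coeFn_toLp, hu] with x hx hx'
  rw [eq_diracSymbol_iff, hx, hx']

theorem dirac_apply_eq_iff {u : (dirac κ).domain} {v : L2} :
    dirac κ u = v ↔ ((u : L2), v) ∈ diracGraph κ := by
  rw [← dirac_graph, LinearPMap.mem_graph_iff]
  constructor
  · rintro rfl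
    exact ⟨u, rfl, rfl⟩
  · rintro ⟨y, hy, hy'⟩
    rwa [← Subtype.ext hy]

end Graph

section Eigenspace

variable {κ : ℝ → ℝ} {L : ℝ} {z : ℂ}

theorem mem_eigenspace_iff {u : (dirac κ).domain} :
    u ∈ eigenspace (dirac κ) z ↔ dirac κ u = z • (u : L2) := by
  rw [eigenspace, LinearMap.mem_ker, shift, LinearMap.sub_apply, sub_eq_zero]
  rfl

theorem exists_isSol_of_mem_diracGraph (hκ : Continuous κ) {u : L2}
    (h : (u, z • u) ∈ diracGraph κ) : ∃ p q : ℝ → ℂ, u =ᵐ[volume] spinor p q ∧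
      MemLp p 2 ∧ MemLp q 2 ∧ IsSol κ (2 / 3 * Complex.I * z) (2 / 3 * Complex.I * z) p q := by
  obtain ⟨U, hU, hu⟩ := exists_isPrimitive_of_mem_diracGraph h
  obtain ⟨p, q, rfl⟩ : ∃ p q, U = spinor p q := ⟨_, _, eq_spinor U⟩
  have hmem : MemLp (spinor p q) 2 := (memLp_congr_ae hu).mp (Lp.memLp u)
  have hU' : IsPrimitive (spinor p q)
      (fun x => derivSymbol (κ x) (spinor p q x) (z • spinor p q x)) := by
    refine hU.congr ?_
    filter_upwards [Lp.coeFn_smul z u, hu] with x hx hx'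
    rw [hx, Pi.smul_apply, hx']
  have hp : IsPrimitive p (fun x => κ x * p x + 2 / 3 * Complex.I * (z * q x)) := hU'.coord 0
  have hq : IsPrimitive q (fun x => -(κ x * q x) + 2 / 3 * Complex.I * (z * p x)) := hU'.coord 1
  have hpc := hp.continuous
  have hqc := hq.continuous
  refine ⟨p, q, hu, hmem.eval_piLp 0, hmem.eval_piLp 1,
    fun x => (hp.hasDerivAt (by fun_prop) x).congr_deriv ?_,
    fun x => (hq.hasDerivAt (by fun_prop) x).congr_deriv ?_⟩
  · rw [Complex.real_smul, mul_assoc _ z]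
  · rw [Complex.real_smul, mul_assoc _ z]
    ring

theorem IsSol.zero_ne_of_ae_eq {b c : ℂ} {p q : ℝ → ℂ} (h : IsSol κ b c p q)
    (hL : ∀ x, |κ x| ≤ L) {u : L2} (hu : u =ᵐ[volume] spinor p q) (h0 : u ≠ 0) :
    p 0 ≠ 0 ∨ q 0 ≠ 0 := by
  by_contra! hcon
  refine h0 (Lp.ext ?_)
  filter_upwards [hu, Lp.coeFn_zero Spinor 2 (volume : Measure ℝ)] with x hx hx'
  obtain ⟨hp, hq⟩ := h.eq_zero hL hcon.1 hcon.2 x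
  rw [hx, hx']
  ext i
  fin_cases i <;> simp [spinor, hp, hq]

theorem exists_smul_eq_of_mem_eigenspace (hκ : Continuous κ) (hL : ∀ x, |κ x| ≤ L)
    {u v : (dirac κ).domain} (hu : u ∈ eigenspace (dirac κ) z) (hv : v ∈ eigenspace (dirac κ) z)
    (h0 : u ≠ 0) : ∃ t : ℂ, t • u = v := by
  rw [mem_eigenspace_iff, dirac_apply_eq_iff] at hu hv
  obtain ⟨p, q, hpq, hp, hq, h⟩ := exists_isSol_of_mem_diracGraph hκ hu
  obtain ⟨p', q', hpq', hp', hq', h'⟩ := exists_isSol_of_mem_diracGraph hκ hv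
  obtain ⟨t, ht⟩ := h.exists_eq_mul_of_memLp hL h'
    (h.zero_ne_of_ae_eq hL hpq (by simpa using h0)) hp hq hp' hq'
  refine ⟨t, Subtype.ext (Lp.ext ?_)⟩
  change ((t • (u : L2) : L2) : ℝ → Spinor) =ᵐ[volume] _
  filter_upwards [hpq, hpq', Lp.coeFn_smul t (u : L2)] with x hx hx' hsmul
  rw [hsmul, Pi.smul_apply, hx, hx']
  ext i
  fin_cases i <;> simp [spinor, ht x]

theorem isSimpleEigenvalue_of_isEigenvalue (hκ : Continuous κ) (hL : ∀ x, |κ x| ≤ L)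
    (h : IsEigenvalue (dirac κ) z) : IsSimpleEigenvalue (dirac κ) z := by
  obtain ⟨u, h0, hu⟩ := h
  have hmem : u ∈ eigenspace (dirac κ) z := mem_eigenspace_iff.mpr hu
  refine (finrank_eq_one_iff_of_nonzero' (⟨u, hmem⟩ : eigenspace (dirac κ) z)
    (fun h => h0 (congrArg Subtype.val h))).mpr fun v => ?_
  obtain ⟨t, ht⟩ := exists_smul_eq_of_mem_eigenspace hκ hL hmem v.2 h0
  exact ⟨t, Subtype.ext ht⟩

theorem finiteDimensional_eigenspace (hκ : Continuous κ) (hL : ∀ x, |κ x| ≤ L) (z : ℂ) :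
    FiniteDimensional ℂ (eigenspace (dirac κ) z) := by
  by_cases h : IsEigenvalue (dirac κ) z
  · exact Module.finite_of_finrank_eq_succ (isSimpleEigenvalue_of_isEigenvalue hκ hL h)
  · have hbot : eigenspace (dirac κ) z = ⊥ := by
      refine (Submodule.eq_bot_iff _).mpr fun u hu => ?_
      by_contra h0
      exact h ⟨u, h0, mem_eigenspace_iff.mp hu⟩
    rw [hbot]
    infer_instance

theorem exists_abs_le_of_tendsto {κp κm : ℝ} (hκ : Continuous κ) (hp : Tendsto κ atTop (𝓝 κp))
    (hm : Tendsto κ atBot (𝓝 κm)) : ∃ L, ∀ x, |κ x| ≤ L := by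
  obtain ⟨X, hX⟩ := mem_atTop_sets.mp (hp.abs.eventually_le_const (lt_add_one |κp|))
  obtain ⟨Y, hY⟩ := mem_atBot_sets.mp (hm.abs.eventually_le_const (lt_add_one |κm|))
  obtain ⟨K, hK⟩ := isCompact_Icc.exists_bound_of_continuousOn (s := Icc Y X) hκ.continuousOn
  refine ⟨max K (max (|κp| + 1) (|κm| + 1)), fun x => ?_⟩
  rcases le_total X x with hx | hx
  · exact le_max_of_le_right (le_max_of_le_left (hX x hx))
  rcases le_total x Y with hx' | hx'
  · exact le_max_of_le_right (le_max_of_le_right (hY x hx'))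
  · exact le_max_of_le_left (hK x ⟨hx', hx⟩)

end Eigenspace

section FredholmCriteria

variable {H : Type*} [NormedAddCommGroup H] [InnerProductSpace ℂ H] {T : H →ₗ.[ℂ] H} {z : ℂ}

theorem exists_shift_eq_of_mem_graph {x y : H} (h : (x, y) ∈ T.graph) :
    ∃ u : T.domain, (u : H) = x ∧ shift T z u = y - z • x := by
  obtain ⟨u, rfl, rfl⟩ := T.mem_graph_iff.mp h
  exact ⟨u, rfl, rfl⟩

section NormBound

variable {F : Type*} [NormedAddCommGroup F] [NormedSpace ℂ F]
  {ℓ : T.domain →ₗ[ℂ] F} {C : ℝ}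

theorem closure_map_ker_le_range [CompleteSpace H] (hT : IsClosed (T.graph : Set (H × H)))
    (hC : ∀ u : T.domain, ‖(u : H)‖ ≤ C * (‖shift T z u‖ + ‖ℓ u‖)) :
    ((LinearMap.ker ℓ).map (shift T z)).topologicalClosure ≤ LinearMap.range (shift T z) := by
  intro y hy
  obtain ⟨f, hf, hfy⟩ := mem_closure_iff_seq_limit.mp hy
  choose u hu huf using hf
  have hnorm (m n : ℕ) : ‖(u m : H) - u n‖ ≤ C * ‖f m - f n‖ := by
    have hmn := hC (u m - u n)
    rwa [(LinearMap.ker ℓ).sub_mem (hu m) (hu n), map_sub, huf, huf, norm_zero, add_zero] at hmn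
  have hcauchy : CauchySeq fun n => (u n : H) := by
    rw [cauchySeq_iff_tendsto_dist_atTop_0]
    have hf0 := (cauchySeq_iff_tendsto_dist_atTop_0.mp hfy.cauchySeq).const_mul C
    rw [mul_zero] at hf0
    refine squeeze_zero (fun _ => dist_nonneg) (fun n => ?_) hf0
    rw [dist_eq_norm, dist_eq_norm]
    exact hnorm _ _
  obtain ⟨x, hx⟩ := cauchySeq_tendsto_of_complete hcauchy
  have hgraph : (x, y + z • x) ∈ T.graph := by
    refine hT.mem_of_tendsto (hx.prodMk_nhds (hfy.add (hx.const_smul z)))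
      (.of_forall fun n => T.mem_graph_iff.mpr ⟨u n, rfl, ?_⟩)
    exact sub_eq_iff_eq_add.mp (huf n)
  obtain ⟨v, -, hv⟩ := exists_shift_eq_of_mem_graph (z := z) hgraph
  exact ⟨v, by rw [hv, add_sub_cancel_right]⟩

variable [FiniteDimensional ℂ F]

theorem finiteDimensional_eigenspace_of_norm_le
    (hC : ∀ u : T.domain, ‖(u : H)‖ ≤ C * (‖shift T z u‖ + ‖ℓ u‖)) :
    FiniteDimensional ℂ (eigenspace T z) := by
  refine FiniteDimensional.of_injective (ℓ ∘ₗ (eigenspace T z).subtype)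
    ((injective_iff_map_eq_zero _).mpr fun u hu => ?_)
  have hℓ : ℓ u = 0 := hu
  have hshift : shift T z u = 0 := u.2
  have hnorm := hC u
  rw [hℓ, hshift, norm_zero, norm_zero, add_zero, mul_zero, norm_le_zero_iff] at hnorm
  exact Subtype.ext (Subtype.ext hnorm)

variable [CompleteSpace H]

theorem isClosed_range_shift_of_norm_le (hT : IsClosed (T.graph : Set (H × H)))
    (hC : ∀ u : T.domain, ‖(u : H)‖ ≤ C * (‖shift T z u‖ + ‖ℓ u‖)) :
    IsClosed (LinearMap.range (shift T z) : Set H) := by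
  obtain ⟨N, hN⟩ := (LinearMap.ker ℓ).exists_isCompl
  have : FiniteDimensional ℂ N :=
    ((LinearMap.ker ℓ).quotientEquivOfIsCompl N hN).symm.trans ℓ.quotKerEquivRange
      |>.symm.finiteDimensional
  have hrange : LinearMap.range (shift T z) =
      ((LinearMap.ker ℓ).map (shift T z)).topologicalClosure ⊔ N.map (shift T z) := by
    refine le_antisymm ?_ (sup_le (closure_map_ker_le_range hT hC) (LinearMap.map_le_range))
    rw [LinearMap.range_eq_map, ← hN.sup_eq_top, Submodule.map_sup]
    exact sup_le_sup_right (Submodule.le_topologicalClosure _) _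
  rw [hrange]
  exact Submodule.isClosed_sup_finiteDimensional _ _ (Submodule.isClosed_topologicalClosure _)

theorem isFredholmAt_of_norm_le (hT : IsClosed (T.graph : Set (H × H)))
    (hC : ∀ u : T.domain, ‖(u : H)‖ ≤ C * (‖shift T z u‖ + ‖ℓ u‖))
    (hrange : FiniteDimensional ℂ (LinearMap.range (shift T z))ᗮ) : IsFredholmAt T z := by
  have hclosed := isClosed_range_shift_of_norm_le hT hC
  have : CompleteSpace (LinearMap.range (shift T z)) := hclosed.completeSpace_coe
  exact ⟨finiteDimensional_eigenspace_of_norm_le hC, hclosed,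
    (Submodule.quotientEquivOfIsCompl _ _
      (Submodule.isCompl_orthogonal _)).symm.finiteDimensional⟩

end NormBound

theorem tendsto_zero_of_tendsto_inner {N : Submodule ℂ H} [FiniteDimensional ℂ N] {k : ℕ → N}
    (h : ∀ v : H, Tendsto (fun n => inner ℂ v (k n : H)) atTop (𝓝 0)) :
    Tendsto k atTop (𝓝 0) := by
  let e := stdOrthonormalBasis ℂ N
  have hsum : Tendsto (fun n => ∑ i, ‖inner ℂ (e i) (k n)‖ ^ 2) atTop (𝓝 0) := by
    simpa using tendsto_finsetSum Finset.univ fun i _ => ((h (e i)).norm.pow 2)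
  simp only [e.sum_sq_norm_inner_right] at hsum
  rw [tendsto_zero_iff_norm_tendsto_zero]
  simpa using hsum.sqrt

variable [CompleteSpace H]

theorem exists_preimage_shift_norm_le (hT : IsClosed (T.graph : Set (H × H)))
    (hclosed : IsClosed (LinearMap.range (shift T z) : Set H)) :
    ∃ C : ℝ, ∀ u : T.domain, ∃ v : T.domain, shift T z v = shift T z u ∧
      ‖(v : H)‖ ≤ C * ‖shift T z u‖ := by
  have : CompleteSpace T.graph := hT.completeSpace_coe
  have : CompleteSpace (LinearMap.range (shift T z)) := hclosed.completeSpace_coe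
  let S₀ : H × H →L[ℂ] H := ContinuousLinearMap.snd ℂ H H - z • ContinuousLinearMap.fst ℂ H H
  have hS₀ (g : T.graph) : S₀ g ∈ LinearMap.range (shift T z) := by
    obtain ⟨v, -, hv⟩ := exists_shift_eq_of_mem_graph (z := z) g.2
    exact ⟨v, hv⟩
  let S : T.graph →L[ℂ] LinearMap.range (shift T z) :=
    (S₀ ∘L T.graph.subtypeL).codRestrict _ hS₀
  have hsurj : Function.Surjective S := by
    rintro ⟨-, u, rfl⟩
    exact ⟨⟨_, T.mem_graph u⟩, rfl⟩
  obtain ⟨C, -, hC⟩ := S.exists_preimage_norm_le hsurj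
  refine ⟨C, fun u => ?_⟩
  obtain ⟨g, hg, hgC⟩ := hC ⟨_, u, rfl⟩
  obtain ⟨v, hv, hvS⟩ := exists_shift_eq_of_mem_graph (z := z) g.2
  refine ⟨v, hvS.trans (congrArg Subtype.val hg), ?_⟩
  rw [hv]
  exact (norm_fst_le _).trans hgC

/-- **Weyl's criterion**. -/
theorem not_isFredholmAt_of_tendsto (hT : IsClosed (T.graph : Set (H × H))) {u : ℕ → T.domain}
    (hnorm : ∀ n, ‖(u n : H)‖ = 1)
    (hweak : ∀ v : H, Tendsto (fun n => inner ℂ v (u n : H)) atTop (𝓝 0))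
    (hshift : Tendsto (fun n => shift T z (u n)) atTop (𝓝 0)) : ¬ IsFredholmAt T z := by
  rintro ⟨hker, hclosed, -⟩
  obtain ⟨C, hC⟩ := exists_preimage_shift_norm_le hT hclosed
  choose v hv hvC using fun n => hC (u n)
  have hv0 : Tendsto (fun n => (v n : H)) atTop (𝓝 0) := by
    refine squeeze_zero_norm hvC ?_
    simpa using hshift.norm.const_mul C
  let N : Submodule ℂ H := (eigenspace T z).map T.domain.subtype
  let k : ℕ → N := fun n => ⟨u n - v n, u n - v n, by
    simp [eigenspace, hv], rfl⟩
  have hk : Tendsto k atTop (𝓝 0) := by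
    refine tendsto_zero_of_tendsto_inner fun w => ?_
    simp only [k, inner_sub_right]
    simpa using (hweak w).sub (tendsto_const_nhds.inner hv0)
  have hu0 : Tendsto (fun n => (u n : H)) atTop (𝓝 0) := by
    have hadd := ((continuous_subtype_val.tendsto (0 : N)).comp hk).add hv0
    simpa [k, Function.comp_def] using hadd
  have hone := hu0.norm
  simp only [hnorm, norm_zero] at hone
  exact one_ne_zero (tendsto_nhds_unique tendsto_const_nhds hone)

end FredholmCriteria

section SelfAdjoint

open scoped ComplexConjugate

variable {κ : ℝ → ℝ} {L : ℝ}

theorem exists_mem_diracGraph (hκ : Continuous κ) (hL : ∀ x, |κ x| ≤ L) {U W : ℝ → Spinor}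
    (h : IsPrimitive U W) (hU : MemLp U 2) (hW : MemLp W 2) :
    ∃ u v : L2, (u, v) ∈ diracGraph κ ∧ u =ᵐ[volume] U ∧
      v =ᵐ[volume] fun x => diracSymbol (κ x) (W x) (U x) := by
  have hV : MemLp (fun x => diracSymbol (κ x) (W x) (U x)) 2 := by
    refine MemLp.of_eval_piLp fun i => ?_
    fin_cases i
    · simp only [Fin.zero_eta, diracSymbol_apply_zero]
      exact ((hW.eval_piLp 1).add (memLp_ofReal_mul hκ hL (hU.eval_piLp 1))).const_mul _
    · simp only [Fin.mk_one, diracSymbol_apply_one]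
      exact ((hW.eval_piLp 0).sub (memLp_ofReal_mul hκ hL (hU.eval_piLp 0))).const_mul _
  refine ⟨hU.toLp U, hV.toLp _, ⟨hW.toLp W, hasL2Deriv_of_isPrimitive
    (h.congr hW.coeFn_toLp.symm) hU.coeFn_toLp, ?_⟩, hU.coeFn_toLp, hV.coeFn_toLp⟩
  filter_upwards [hU.coeFn_toLp, hW.coeFn_toLp, hV.coeFn_toLp] with x hx hx' hx''
  rw [hx, hx', hx'']

theorem inner_diracSymbol_sub (k : ℝ) (a u w w' : Spinor) :
    inner ℂ (diracSymbol k w a) u - inner ℂ a (diracSymbol k w' u) =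
      3 / 2 * Complex.I * ((conj (a 0) * w' 1 + conj (w 0) * u 1) +
        (conj (a 1) * w' 0 + conj (w 1) * u 0)) := by
  simp only [PiLp.inner_apply, Fin.sum_univ_two, RCLike.inner_apply, diracSymbol_apply_zero,
    diracSymbol_apply_one, map_mul, map_neg, map_add, map_sub, map_div₀, Complex.conj_I,
    Complex.conj_ofReal, map_ofNat]
  ring

theorem integrable_conj_mul {P Q : ℝ → ℂ} (hP : MemLp P 2) (hQ : MemLp Q 2) :
    Integrable fun x => conj (P x) * Q x :=
  hP.star.integrable_mul hQ

theorem integrable_conj_mul_add {P Q p q : ℝ → ℂ} (hP : MemLp P 2) (hQ : MemLp Q 2)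
    (hp : MemLp p 2) (hq : MemLp q 2) :
    Integrable fun x => conj (P x) * q x + conj (p x) * Q x :=
  (integrable_conj_mul hP hq).add (integrable_conj_mul hp hQ)

theorem inner_eq_inner_of_mem_diracGraph {a b u v : L2} (hab : (a, b) ∈ diracGraph κ)
    (huv : (u, v) ∈ diracGraph κ) : inner ℂ b u = inner ℂ a v := by
  obtain ⟨w, hw, hb⟩ := hab
  obtain ⟨w', hw', hv⟩ := huv
  obtain ⟨A, hA, haA⟩ := exists_isPrimitive hw
  obtain ⟨U, hU, huU⟩ := exists_isPrimitive hw'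
  have hmem (f : L2) (i : Fin 2) : MemLp (fun x => f x i) 2 := (Lp.memLp f).eval_piLp i
  have hAm (i : Fin 2) : MemLp (fun x => A x i) 2 :=
    ((memLp_congr_ae haA).mp (Lp.memLp a)).eval_piLp i
  have hUm (i : Fin 2) : MemLp (fun x => U x i) 2 :=
    ((memLp_congr_ae huU).mp (Lp.memLp u)).eval_piLp i
  have hint (i j : Fin 2) := integrable_conj_mul_add (hAm i) (hUm j) (hmem w i) (hmem w' j)
  have hzero (i j : Fin 2) : ∫ x, (conj (A x i) * w' x j + conj (w x i) * U x j) = 0 :=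
    ((hA.coord i).conj_mul (hU.coord j)).integral_eq_zero
      (integrable_conj_mul (hAm i) (hUm j)) (hint i j)
  have hgreen : (fun x => inner ℂ (b x) (u x) - inner ℂ (a x) (v x)) =ᵐ[volume] fun x =>
      3 / 2 * Complex.I * ((conj (A x 0) * w' x 1 + conj (w x 0) * U x 1) +
        (conj (A x 1) * w' x 0 + conj (w x 1) * U x 0)) := by
    filter_upwards [haA, huU, hb, hv] with x hax hux hbx hvx
    rw [hbx, hvx, inner_diracSymbol_sub, hax, hux]
  rw [L2.inner_def, L2.inner_def, ← sub_eq_zero,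
    ← integral_sub (L2.integrable_inner b u) (L2.integrable_inner a v), integral_congr_ae hgreen,
    integral_const_mul, integral_add (hint 0 1) (hint 1 0), hzero, hzero, add_zero, mul_zero]

theorem integral_schwartz_smul_add_eq_zero (hκ : Continuous κ) (hL : ∀ x, |κ x| ≤ L) {u v w : L2}
    (hv : v =ᵐ[volume] fun x => diracSymbol (κ x) (w x) (u x))
    (h : ∀ a b : L2, (a, b) ∈ diracGraph κ → inner ℂ b u = inner ℂ a v) (φ : 𝓢(ℝ, ℂ)) :
    ∫ x, (φ x • w x + SchwartzMap.derivCLM ℂ ℂ φ x • u x) = 0 := by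
  let φ' := SchwartzMap.derivCLM ℂ ℂ φ
  have hgreen (e : Spinor) : ∫ x, (conj (e 0) * (φ x • w x + φ' x • u x) 1 +
      conj (e 1) * (φ x • w x + φ' x • u x) 0) = 0 := by
    let S : ℂ →L[ℝ] Spinor := (ContinuousLinearMap.toSpanSingleton ℂ e).restrictScalars ℝ ∘L
      Complex.conjCLE.toContinuousLinearMap
    have hφ : IsPrimitive φ φ' := .of_hasDerivAt φ'.continuous φ.hasDerivAt
    obtain ⟨a, b, hab, ha, hb⟩ := exists_mem_diracGraph hκ hL (hφ.clm_comp S)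
      (S.comp_memLp' (φ.memLp 2)) (S.comp_memLp' (φ'.memLp 2))
    have hsub := sub_eq_zero.mpr (h a b hab)
    rw [L2.inner_def, L2.inner_def,
      ← integral_sub (L2.integrable_inner b u) (L2.integrable_inner a v)] at hsub
    refine (mul_eq_zero.mp ((integral_const_mul (3 / 2 * Complex.I) _).symm.trans
      ((integral_congr_ae ?_).trans hsub))).resolve_left (by simp)
    filter_upwards [ha, hb, hv] with x hax hbx hvx
    rw [hax, hbx, hvx, inner_diracSymbol_sub]
    simp [S]
    ring
  have hint := (integrable_schwartz_smul φ w).add (integrable_schwartz_smul φ' u)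
  have hcoord (i : Fin 2) := (EuclideanSpace.proj (𝕜 := ℂ) i).integral_comp_comm hint
  ext i
  refine (hcoord i).symm.trans ?_
  fin_cases i
  · simpa using hgreen (EuclideanSpace.single 1 1)
  · simpa using hgreen (EuclideanSpace.single 0 1)

theorem mem_diracGraph_of_forall_inner_eq (hκ : Continuous κ) (hL : ∀ x, |κ x| ≤ L) {u v : L2}
    (h : ∀ a b : L2, (a, b) ∈ diracGraph κ → inner ℂ b u = inner ℂ a v) :
    (u, v) ∈ diracGraph κ := by
  have hW := memLp_derivSymbol hκ hL (Lp.memLp u) (Lp.memLp v)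
  have hv : v =ᵐ[volume] fun x => diracSymbol (κ x) (hW.toLp _ x) (u x) := by
    filter_upwards [hW.coeFn_toLp] with x hx
    rw [eq_diracSymbol_iff, hx]
  refine ⟨hW.toLp _, ?_, hv⟩
  ext φ : 1
  have hzero := integral_schwartz_smul_add_eq_zero hκ hL hv h φ
  rw [integral_add (integrable_schwartz_smul φ _) (integrable_schwartz_smul _ u)] at hzero
  rw [TemperedDistribution.derivCLM_apply_apply, map_neg, Lp.toTemperedDistribution_apply,
    Lp.toTemperedDistribution_apply, eq_neg_of_add_eq_zero_left hzero]

theorem isClosed_diracGraph (hκ : Continuous κ) (hL : ∀ x, |κ x| ≤ L) :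
    IsClosed (diracGraph κ : Set (L2 × L2)) := by
  have hsymm : (diracGraph κ : Set (L2 × L2)) =
      {p | ∀ a b : L2, (a, b) ∈ diracGraph κ → inner ℂ b p.1 = inner ℂ a p.2} :=
    Subset.antisymm (fun _ hp _ _ hab => inner_eq_inner_of_mem_diracGraph hab hp)
      fun _ hp => mem_diracGraph_of_forall_inner_eq hκ hL hp
  rw [hsymm]
  simp only [ofPred_forall]
  exact isClosed_iInter fun a => isClosed_iInter fun b => isClosed_iInter fun _ =>
    isClosed_eq (continuous_const.inner continuous_fst) (continuous_const.inner continuous_snd)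

theorem finiteDimensional_orthogonal_range_shift (hκ : Continuous κ) (hL : ∀ x, |κ x| ≤ L)
    (z : ℂ) : FiniteDimensional ℂ (LinearMap.range (shift (dirac κ) z))ᗮ := by
  have hle : (LinearMap.range (shift (dirac κ) z))ᗮ ≤
      (eigenspace (dirac κ) (conj z)).map (dirac κ).domain.subtype := by
    intro v hv
    have hmem : (v, conj z • v) ∈ diracGraph κ := by
      refine mem_diracGraph_of_forall_inner_eq hκ hL fun a b hab => ?_
      obtain ⟨u, -, hu⟩ := exists_shift_eq_of_mem_graph (z := z) (by rwa [dirac_graph])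
      have horth : inner ℂ (b - z • a) v = 0 := hu ▸ hv _ ⟨u, rfl⟩
      rwa [inner_sub_left, inner_smul_left, ← inner_smul_right, sub_eq_zero] at horth
    obtain ⟨u, rfl, hu⟩ := (dirac κ).mem_graph_iff.mp (by rwa [dirac_graph])
    exact ⟨u, mem_eigenspace_iff.mpr hu, rfl⟩
  have := finiteDimensional_eigenspace hκ hL (conj z)
  exact Submodule.finiteDimensional_of_le hle

end SelfAdjoint

section Fredholm

variable {κ : ℝ → ℝ} {L : ℝ}

/-- The continuous representative of an element of the domain of the Dirac operator. -/
def contRep (u : (dirac κ).domain) : ℝ → Spinor :=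
  (exists_isPrimitive_of_mem_diracGraph (dirac_apply_eq_iff.mp (Eq.refl (dirac κ u)))).choose

theorem isPrimitive_contRep (u : (dirac κ).domain) :
    IsPrimitive (contRep u) fun x => derivSymbol (κ x) (contRep u x) (dirac κ u x) :=
  (exists_isPrimitive_of_mem_diracGraph
    (dirac_apply_eq_iff.mp (Eq.refl (dirac κ u)))).choose_spec.1

theorem ae_eq_contRep (u : (dirac κ).domain) : (u : L2) =ᵐ[volume] contRep u :=
  (exists_isPrimitive_of_mem_diracGraph
    (dirac_apply_eq_iff.mp (Eq.refl (dirac κ u)))).choose_spec.2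

theorem contRep_eq_of_ae_eq {u : (dirac κ).domain} {U : ℝ → Spinor} (hU : Continuous U)
    (h : (u : L2) =ᵐ[volume] U) : contRep u = U :=
  Continuous.ae_eq_iff_eq volume (isPrimitive_contRep u).continuous hU |>.mp
    ((ae_eq_contRep u).symm.trans h)

variable (κ) in
/-- Evaluation of the continuous representative at the origin. -/
def evalZero : (dirac κ).domain →ₗ[ℂ] Spinor where
  toFun u := contRep u 0
  map_add' u v := by
    refine congrFun (contRep_eq_of_ae_eq (U := fun x => contRep u x + contRep v x)
      ((isPrimitive_contRep u).continuous.add (isPrimitive_contRep v).continuous) ?_) 0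
    exact (Lp.coeFn_add _ _).trans ((ae_eq_contRep u).add (ae_eq_contRep v))
  map_smul' c u := by
    refine congrFun (contRep_eq_of_ae_eq (U := fun x => c • contRep u x)
      ((isPrimitive_contRep u).continuous.const_smul c) ?_) 0
    exact (Lp.coeFn_smul c _).trans ((ae_eq_contRep u).const_smul c)

theorem norm_sq_eq_integral (u : L2) : ‖u‖ ^ 2 = ∫ x, ‖u x‖ ^ 2 := by
  have hsq {H : Type} [NormedAddCommGroup H] [InnerProductSpace ℂ H] (v : H) :
      ‖v‖ ^ 2 = RCLike.re (inner ℂ v v) := InnerProductSpace.norm_sq_eq_re_inner v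
  simp only [hsq, L2.inner_def]
  exact (integral_re (L2.integrable_inner u u)).symm

theorem norm_sq_eq_add (u : Spinor) : ‖u‖ ^ 2 = ‖u 0‖ ^ 2 + ‖u 1‖ ^ 2 := by
  rw [EuclideanSpace.norm_sq_eq, Fin.sum_univ_two]

theorem abs_norm_sq_sub_le (u : Spinor) : |‖u 0‖ ^ 2 - ‖u 1‖ ^ 2| ≤ ‖u‖ ^ 2 := by
  rw [norm_sq_eq_add u]
  exact abs_le.mpr ⟨by linarith [sq_nonneg ‖u 0‖], by linarith [sq_nonneg ‖u 1‖]⟩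

theorem abs_inner_I_mul_add_le (u v : Spinor) :
    |inner ℝ (u 0) (Complex.I * v 1)| + |inner ℝ (u 1) (Complex.I * v 0)| ≤ ‖u‖ * ‖v‖ := by
  have hinner (z w : ℂ) : |inner ℝ z (Complex.I * w)| ≤ ‖z‖ * ‖w‖ := by
    simpa using abs_real_inner_le_norm z (Complex.I * w)
  refine (add_le_add (hinner _ _) (hinner _ _)).trans (abs_le_of_sq_le_sq' ?_ (by positivity)).2
  rw [mul_pow, norm_sq_eq_add, norm_sq_eq_add]
  linarith [sq_nonneg (‖u 0‖ * ‖v 0‖ - ‖u 1‖ * ‖v 1‖)]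

theorem inner_derivSymbol_zero (k : ℝ) (u v : Spinor) : inner ℝ (u 0) (derivSymbol k u v 0) =
    k * ‖u 0‖ ^ 2 + 2 / 3 * inner ℝ (u 0) (Complex.I * v 1) := by
  rw [Complex.sq_norm]
  simp [derivSymbol, Complex.inner, Complex.normSq_apply]
  ring

theorem inner_derivSymbol_one (k : ℝ) (u v : Spinor) : inner ℝ (u 1) (derivSymbol k u v 1) =
    -(k * ‖u 1‖ ^ 2) + 2 / 3 * inner ℝ (u 1) (Complex.I * v 0) := by
  rw [Complex.sq_norm]
  simp [derivSymbol, Complex.inner, Complex.normSq_apply]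
  ring

theorem abs_inner_add_inner_le (k : ℝ) (u v : Spinor) :
    |inner ℝ (u 0) (derivSymbol k u v 0) + inner ℝ (u 1) (derivSymbol k u v 1)| ≤
      |k| * ‖u‖ ^ 2 + 2 / 3 * (‖u‖ * ‖v‖) := by
  rw [inner_derivSymbol_zero, inner_derivSymbol_one]
  set A := inner ℝ (u 0) (Complex.I * v 1)
  set B := inner ℝ (u 1) (Complex.I * v 0)
  calc _ = |k * (‖u 0‖ ^ 2 - ‖u 1‖ ^ 2) + 2 / 3 * (A + B)| := by congr 1; ring
    _ ≤ |k| * |‖u 0‖ ^ 2 - ‖u 1‖ ^ 2| + 2 / 3 * |A + B| := by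
      refine (abs_add_le _ _).trans_eq ?_
      rw [abs_mul, abs_mul, abs_of_pos (by norm_num : (0 : ℝ) < 2 / 3)]
    _ ≤ |k| * ‖u‖ ^ 2 + 2 / 3 * (‖u‖ * ‖v‖) := by
      gcongr
      exacts [abs_norm_sq_sub_le u, (abs_add_le A B).trans (abs_inner_I_mul_add_le u v)]

theorem abs_inner_sub_inner_sub_le (k : ℝ) (u v : Spinor) :
    |inner ℝ (u 0) (derivSymbol k u v 0) - inner ℝ (u 1) (derivSymbol k u v 1) - k * ‖u‖ ^ 2| ≤
      2 / 3 * (‖u‖ * ‖v‖) := by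
  rw [inner_derivSymbol_zero, inner_derivSymbol_one, norm_sq_eq_add u]
  set A := inner ℝ (u 0) (Complex.I * v 1)
  set B := inner ℝ (u 1) (Complex.I * v 0)
  calc _ = |2 / 3 * (A - B)| := by congr 1; ring
    _ = 2 / 3 * |A - B| := by rw [abs_mul, abs_of_pos (by norm_num)]
    _ ≤ 2 / 3 * (‖u‖ * ‖v‖) := by
      gcongr
      exact (abs_sub A B).trans (abs_inner_I_mul_add_le u v)

theorem exists_hasDerivAt_tendsto (a b : ℝ) : ∃ η η' : ℝ → ℝ, (∀ x, HasDerivAt η (η' x) x) ∧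
    Continuous η' ∧ Tendsto η atTop (𝓝 a) ∧ Tendsto η atBot (𝓝 b) ∧
    Tendsto η' atTop (𝓝 0) ∧ Tendsto η' atBot (𝓝 0) := by
  have hπ := Real.pi_ne_zero
  have htop := tendsto_nhds_of_tendsto_nhdsWithin Real.tendsto_arctan_atTop
  have hbot := tendsto_nhds_of_tendsto_nhdsWithin Real.tendsto_arctan_atBot
  have hcob : Tendsto (fun x : ℝ => 1 + x ^ 2) (Bornology.cobounded ℝ) atTop := by
    refine tendsto_atTop_add_const_left _ _ ?_
    exact ((tendsto_pow_atTop two_ne_zero).comp tendsto_norm_cobounded_atTop).congr sq_abs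
  have hinv : Tendsto (fun x : ℝ => (a - b) * (1 / (1 + x ^ 2) / Real.pi))
      (Bornology.cobounded ℝ) (𝓝 0) := by
    simpa using ((hcob.inv_tendsto_atTop.div_const Real.pi).const_mul (a - b))
  refine ⟨fun x => b + (a - b) * (Real.arctan x / Real.pi + 1 / 2), _,
    fun x => ((((Real.hasDerivAt_arctan x).div_const _).add_const _).const_mul _).const_add b,
    ?_, ?_, ?_, hinv.mono_left IsOrderBornology.atTop_le_cobounded,
    hinv.mono_left IsOrderBornology.atBot_le_cobounded⟩
  · exact continuous_const.mul
      ((continuous_const.div (by fun_prop) fun x => by positivity).div_const _)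
  · convert (((htop.div_const Real.pi).add_const (1 / 2)).const_mul (a - b)).const_add b using 2
    field_simp
    ring
  · convert (((hbot.div_const Real.pi).add_const (1 / 2)).const_mul (a - b)).const_add b using 2
    field_simp
    ring

/-- Any `η` with the same limits as `κ` and `η'` tending to zero will do, because then
`2 (η κ - β |η|)` tends to `2 |κ±| (|κ±| - β) > 0`. -/
theorem exists_multiplier (hκ : Continuous κ) {κp κm β : ℝ} (hp : Tendsto κ atTop (𝓝 κp))
    (hm : Tendsto κ atBot (𝓝 κm)) (hβp : β < |κp|) (hβm : β < |κm|) (hβ : 0 ≤ β) :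
    ∃ (η η' : ℝ → ℝ) (C δ R M : ℝ), (∀ x, HasDerivAt η (η' x) x) ∧ Continuous η' ∧
      (∀ x, |η x| ≤ C) ∧ (∀ x, |η' x| ≤ C) ∧ 0 < δ ∧ 0 ≤ R ∧ 0 ≤ M ∧
      ∀ x, δ ≤ 2 * (η x * κ x - |η x| * β) - |η' x| + (Icc (-R) R).indicator (fun _ => M) x := by
  obtain ⟨η, η', hd, hη', htop, hbot, htop', hbot'⟩ := exists_hasDerivAt_tendsto κp κm
  have hη : Continuous η := continuous_iff_continuousAt.mpr fun x => (hd x).continuousAt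
  obtain ⟨C, hC⟩ := exists_abs_le_of_tendsto hη htop hbot
  obtain ⟨C', hC'⟩ := exists_abs_le_of_tendsto hη' htop' hbot'
  set F : ℝ → ℝ := fun x => 2 * (η x * κ x - |η x| * β) - |η' x|
  have hpos {k : ℝ} (hk : β < |k|) : 0 < 2 * (k * k - |k| * β) - |0| := by
    rw [← abs_mul_abs_self k, abs_zero]
    have := mul_pos (hβ.trans_lt hk) (sub_pos.mpr hk)
    linarith
  have hlim {l : Filter ℝ} {k : ℝ} (hk : Tendsto κ l (𝓝 k)) (hl : Tendsto η l (𝓝 k))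
      (hl' : Tendsto η' l (𝓝 0)) : Tendsto F l (𝓝 (2 * (k * k - |k| * β) - |0|)) :=
    (((hl.mul hk).sub (hl.abs.mul_const β)).const_mul 2).sub hl'.abs
  obtain ⟨δ, hδ, hδ'⟩ := exists_between (lt_min (hpos hβp) (hpos hβm))
  obtain ⟨X, hX⟩ := eventually_atTop.mp
    ((hlim hp htop htop').eventually_const_le (hδ'.trans_le (min_le_left _ _)))
  obtain ⟨Y, hY⟩ := eventually_atBot.mp
    ((hlim hm hbot hbot').eventually_const_le (hδ'.trans_le (min_le_right _ _)))
  set R := max |X| |Y|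
  have hR : 0 ≤ R := (abs_nonneg X).trans (le_max_left _ _)
  have hFc : Continuous F := by fun_prop
  obtain ⟨K, hK⟩ := isCompact_Icc.exists_bound_of_continuousOn (s := Icc (-R) R) hFc.continuousOn
  have hK0 : 0 ≤ K := (norm_nonneg _).trans (hK 0 ⟨neg_nonpos.mpr hR, hR⟩)
  refine ⟨η, η', max C C', δ, R, δ + K, hd, hη', fun x => (hC x).trans (le_max_left _ _),
    fun x => (hC' x).trans (le_max_right _ _), hδ, hR, add_nonneg hδ.le hK0, fun x => ?_⟩
  change δ ≤ F x + _
  by_cases hx : x ∈ Icc (-R) R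
  · rw [indicator_of_mem hx]
    linarith [(abs_le.mp (hK x hx)).1]
  · rw [indicator_of_notMem hx, add_zero]
    rw [mem_Icc, not_and_or, not_le, not_le] at hx
    rcases hx with hx | hx
    · exact hY x (by linarith [neg_abs_le Y, le_max_right |X| |Y|])
    · exact hX x (by linarith [le_abs_self X, le_max_left |X| |Y|])

theorem integral_le_of_multiplier {n n' N N' g : ℝ → ℝ} {K B M R δ : ℝ} (hn : IsPrimitive n n')
    (hN : IsPrimitive N N') (hni : Integrable n) (hNi : Integrable N) (hN'i : Integrable N')
    (hg : Integrable g) (hn0 : ∀ x, 0 ≤ n x) (hg0 : ∀ x, 0 ≤ g x) (hK : 0 ≤ K) (hB : 0 ≤ B)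
    (hM : 0 ≤ M) (hR : 0 ≤ R) (hδ : 0 < δ) (hn' : ∀ᵐ x, |n' x| ≤ K * n x + g x)
    (hN' : ∀ᵐ x, δ * n x ≤ N' x + (Icc (-R) R).indicator (fun x => M * n x) x + B * g x) :
    ∫ x, n x ≤ δ⁻¹ * (M * (2 * R * Real.exp (K * R)) + B) * (n 0 + ∫ x, g x) := by
  set A := n 0 + ∫ x, g x
  have hgA : ∫ x, g x ≤ A := le_add_of_nonneg_left (hn0 0)
  have hA : 0 ≤ A := add_nonneg (hn0 0) (integral_nonneg hg0)
  have hlocal : ∫ x in Icc (-R) R, n x ≤ 2 * R * Real.exp (K * R) * A := by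
    have hbound : ∀ x ∈ Icc (-R) R, n x ≤ Real.exp (K * R) * A := fun x hx =>
      (hn.le_exp_mul_abs hK hg hg0 hn' x).trans (by gcongr; exact abs_le.mpr hx)
    refine (setIntegral_mono_on hni.integrableOn (integrableOn_const (by simp))
      measurableSet_Icc hbound).trans_eq ?_
    rw [setIntegral_const, Real.volume_real_Icc_of_le (by linarith), smul_eq_mul]
    ring
  have hind : Integrable ((Icc (-R) R).indicator fun x => M * n x) :=
    (hni.const_mul M).indicator measurableSet_Icc
  have hglobal : δ * ∫ x, n x ≤ M * (∫ x in Icc (-R) R, n x) + B * ∫ x, g x := by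
    rw [← integral_const_mul]
    refine (integral_mono_ae (hni.const_mul δ) ((hN'i.add hind).add (hg.const_mul B)) hN').trans_eq
      ?_
    rw [integral_add' (hN'i.add hind) (hg.const_mul B), integral_add' hN'i hind,
      hN.integral_eq_zero hNi hN'i, integral_indicator measurableSet_Icc, integral_const_mul,
      integral_const_mul, zero_add]
  rw [mul_assoc, ← div_eq_inv_mul, le_div_iff₀' hδ, add_mul, mul_assoc M]
  exact hglobal.trans (add_le_add (mul_le_mul_of_nonneg_left hlocal hM)
    (mul_le_mul_of_nonneg_left hgA hB))

theorem IsPrimitive.norm_sq_add {U u : ℝ → Spinor} (h : IsPrimitive U u) :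
    IsPrimitive (fun x => ‖U x‖ ^ 2)
      (fun x => 2 * (inner ℝ (U x 0) (u x 0) + inner ℝ (U x 1) (u x 1))) := by
  simpa only [norm_sq_eq_add, mul_add] using (h.coord 0).norm_sq.add (h.coord 1).norm_sq

theorem IsPrimitive.norm_sq_sub {U u : ℝ → Spinor} (h : IsPrimitive U u) :
    IsPrimitive (fun x => ‖U x 0‖ ^ 2 - ‖U x 1‖ ^ 2)
      (fun x => 2 * (inner ℝ (U x 0) (u x 0) - inner ℝ (U x 1) (u x 1))) := by
  simpa only [mul_sub] using (h.coord 0).norm_sq.sub (h.coord 1).norm_sq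

theorem integrable_norm_sq_sub {U : ℝ → Spinor} (hU : MemLp U 2) :
    Integrable fun x => ‖U x 0‖ ^ 2 - ‖U x 1‖ ^ 2 :=
  have hsq (i : Fin 2) : Integrable fun x => ‖U x i‖ ^ 2 :=
    (memLp_two_iff_integrable_sq_norm (hU.eval_piLp i).1).mp (hU.eval_piLp i)
  (hsq 0).sub (hsq 1)

theorem integrable_inner_sub_inner {U u : ℝ → Spinor} (hU : MemLp U 2) (hu : MemLp u 2) :
    Integrable fun x => 2 * (inner ℝ (U x 0) (u x 0) - inner ℝ (U x 1) (u x 1)) := by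
  have hinner (i : Fin 2) : Integrable fun x => inner ℝ (U x i) (u x i) :=
    ((integrable_conj_mul (hU.eval_piLp i) (hu.eval_piLp i)).re).congr
      (.of_forall fun x => by simp [Complex.inner]; ring)
  exact ((hinner 0).sub (hinner 1)).const_mul 2

theorem abs_deriv_norm_sq_le {k a φ : ℝ} {u v : Spinor} (hk : |k| ≤ L) (hv : ‖v‖ ≤ a * ‖u‖ + φ) :
    |2 * (inner ℝ (u 0) (derivSymbol k u v 0) + inner ℝ (u 1) (derivSymbol k u v 1))| ≤
      (2 * L + 4 / 3 * a + 1) * ‖u‖ ^ 2 + φ ^ 2 := by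
  rw [abs_mul, abs_two]
  have hk' := mul_le_mul_of_nonneg_right hk (sq_nonneg ‖u‖)
  have hv' := mul_le_mul_of_nonneg_left hv (norm_nonneg u)
  linarith [abs_inner_add_inner_le k u v, sq_nonneg (‖u‖ - φ), sq_nonneg (‖u‖), sq_nonneg φ]

theorem le_deriv_multiplier {k a φ η η' C δ m : ℝ} {u v : Spinor} (hv : ‖v‖ ≤ a * ‖u‖ + φ)
    (hφ : 0 ≤ φ) (hη : |η| ≤ C) (hδ : 0 < δ)
    (hm : δ ≤ 2 * (η * k - |η| * (2 / 3 * a)) - |η'| + m) :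
    δ / 2 * ‖u‖ ^ 2 ≤
      η * (2 * (inner ℝ (u 0) (derivSymbol k u v 0) - inner ℝ (u 1) (derivSymbol k u v 1))) +
        η' * (‖u 0‖ ^ 2 - ‖u 1‖ ^ 2) + m * ‖u‖ ^ 2 + 8 / 9 * C ^ 2 / δ * φ ^ 2 := by
  set S := inner ℝ (u 0) (derivSymbol k u v 0) - inner ℝ (u 1) (derivSymbol k u v 1)
  have hS : η * (k * ‖u‖ ^ 2) - |η| * (2 / 3 * (‖u‖ * (a * ‖u‖ + φ))) ≤ η * S := by
    have habs : |η * (S - k * ‖u‖ ^ 2)| ≤ |η| * (2 / 3 * (‖u‖ * (a * ‖u‖ + φ))) := by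
      rw [abs_mul]
      gcongr
      exact (abs_inner_sub_inner_sub_le k u v).trans (by gcongr)
    linarith [neg_le_of_abs_le habs]
  have hη' : -(|η'| * ‖u‖ ^ 2) ≤ η' * (‖u 0‖ ^ 2 - ‖u 1‖ ^ 2) := by
    refine neg_le_of_abs_le ?_
    rw [abs_mul]
    gcongr
    exact abs_norm_sq_sub_le u
  have hcross : 4 / 3 * |η| * (‖u‖ * φ) ≤ δ / 2 * ‖u‖ ^ 2 + 8 / 9 * C ^ 2 / δ * φ ^ 2 := by
    have hsq : 0 ≤ (δ * ‖u‖ - 4 / 3 * C * φ) ^ 2 / (2 * δ) := by positivity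
    have hexp : (δ * ‖u‖ - 4 / 3 * C * φ) ^ 2 / (2 * δ) =
        δ / 2 * ‖u‖ ^ 2 + 8 / 9 * C ^ 2 / δ * φ ^ 2 - 4 / 3 * C * (‖u‖ * φ) := by
      field_simp
      ring
    have hC : 4 / 3 * |η| * (‖u‖ * φ) ≤ 4 / 3 * C * (‖u‖ * φ) := by gcongr
    linarith
  have hmul := mul_le_mul_of_nonneg_right hm (sq_nonneg ‖u‖)
  linarith

variable {κp κm : ℝ} {z : ℂ}

theorem exists_norm_sq_le (hκ : Continuous κ) (hp : Tendsto κ atTop (𝓝 κp))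
    (hm : Tendsto κ atBot (𝓝 κm)) (hzp : 2 / 3 * ‖z‖ < |κp|) (hzm : 2 / 3 * ‖z‖ < |κm|) :
    ∃ C, 0 ≤ C ∧ ∀ u : (dirac κ).domain,
      ‖(u : L2)‖ ^ 2 ≤ C * (‖evalZero κ u‖ ^ 2 + ‖shift (dirac κ) z u‖ ^ 2) := by
  obtain ⟨L, hL⟩ := exists_abs_le_of_tendsto hκ hp hm
  obtain ⟨η, η', C, δ, R, M, hd, hη', hC, hC', hδ, hR, hM, hmul⟩ :=
    exists_multiplier hκ hp hm hzp hzm (by positivity)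
  have hL0 : 0 ≤ L := (abs_nonneg _).trans (hL 0)
  have hη : IsPrimitive η η' := .of_hasDerivAt hη' hd
  refine ⟨(δ / 2)⁻¹ * (M * (2 * R * Real.exp ((2 * L + 4 / 3 * ‖z‖ + 1) * R)) +
    8 / 9 * C ^ 2 / δ), by positivity, fun u => ?_⟩
  set U := contRep u
  set f : L2 := shift (dirac κ) z u
  have hU : IsPrimitive U fun x => derivSymbol (κ x) (U x) (dirac κ u x) := isPrimitive_contRep u
  have hUmem : MemLp U 2 := (memLp_congr_ae (ae_eq_contRep u)).mp (Lp.memLp _)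
  have hw := memLp_derivSymbol hκ hL hUmem (Lp.memLp (dirac κ u))
  have hv : ∀ᵐ x, ‖dirac κ u x‖ ≤ ‖z‖ * ‖U x‖ + ‖f x‖ := by
    have hf : dirac κ u = z • (u : L2) + f := (add_sub_cancel _ _).symm
    filter_upwards [Lp.coeFn_add (z • (u : L2)) f, Lp.coeFn_smul z (u : L2), ae_eq_contRep u]
      with x hadd hsmul hx
    rw [hf, hadd, Pi.add_apply, hsmul, Pi.smul_apply, hx, ← norm_smul]
    exact norm_add_le _ _
  have hu : ‖(u : L2)‖ ^ 2 = ∫ x, ‖U x‖ ^ 2 := by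
    rw [norm_sq_eq_integral]
    exact integral_congr_ae ((ae_eq_contRep u).mono fun x hx => by simp only [hx, U])
  have hN' : Integrable fun x => η x * (2 * (inner ℝ (U x 0) (derivSymbol (κ x) (U x)
      (dirac κ u x) 0) - inner ℝ (U x 1) (derivSymbol (κ x) (U x) (dirac κ u x) 1))) +
      η' x * (‖U x 0‖ ^ 2 - ‖U x 1‖ ^ 2) :=
    ((integrable_inner_sub_inner hUmem hw).bdd_mul hη.continuous.aestronglyMeasurable
      (.of_forall hC)).add ((integrable_norm_sq_sub hUmem).bdd_mul hη'.aestronglyMeasurable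
      (.of_forall hC'))
  rw [hu, norm_sq_eq_integral f]
  refine integral_le_of_multiplier hU.norm_sq_add (hη.smul hU.norm_sq_sub)
    ((memLp_two_iff_integrable_sq_norm hUmem.1).mp hUmem)
    ((integrable_norm_sq_sub hUmem).bdd_mul hη.continuous.aestronglyMeasurable (.of_forall hC))
    hN' ((memLp_two_iff_integrable_sq_norm (Lp.memLp f).1).mp (Lp.memLp f))
    (fun x => sq_nonneg _) (fun x => sq_nonneg _) (by positivity) (by positivity) hM hR
    (half_pos hδ) (hv.mono fun x hx => abs_deriv_norm_sq_le (hL x) hx) (hv.mono fun x hx => ?_)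
  rw [indicator_mul_left]
  exact le_deriv_multiplier hx (norm_nonneg _) (hC x) hδ (hmul x)

theorem exists_norm_le (hκ : Continuous κ) (hp : Tendsto κ atTop (𝓝 κp))
    (hm : Tendsto κ atBot (𝓝 κm)) (hzp : 2 / 3 * ‖z‖ < |κp|) (hzm : 2 / 3 * ‖z‖ < |κm|) :
    ∃ C, ∀ u : (dirac κ).domain,
      ‖(u : L2)‖ ≤ C * (‖shift (dirac κ) z u‖ + ‖evalZero κ u‖) := by
  obtain ⟨C, hC, h⟩ := exists_norm_sq_le hκ hp hm hzp hzm
  refine ⟨√C, fun u => (sq_le_sq₀ (norm_nonneg _) (by positivity)).mp ((h u).trans ?_)⟩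
  rw [mul_pow, Real.sq_sqrt hC]
  gcongr
  linarith [mul_nonneg (norm_nonneg (shift (dirac κ) z u)) (norm_nonneg (evalZero κ u))]

theorem abs_im_mul_norm_le (u : (dirac κ).domain) :
    |z.im| * ‖(u : L2)‖ ≤ ‖shift (dirac κ) z u‖ := by
  have hmem : ((u : L2), dirac κ u) ∈ diracGraph κ := dirac_apply_eq_iff.mp (Eq.refl (dirac κ u))
  have hreal : (inner ℂ (u : L2) (dirac κ u)).im = 0 := by
    rw [← Complex.conj_eq_iff_im, inner_conj_symm, inner_eq_inner_of_mem_diracGraph hmem hmem]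
  have him : (inner ℂ (u : L2) (shift (dirac κ) z u)).im = -(z.im * ‖(u : L2)‖ ^ 2) := by
    change (inner ℂ (u : L2) (dirac κ u - z • (u : L2))).im = _
    rw [inner_sub_right, inner_smul_right, inner_self_eq_norm_sq_to_K, Complex.sub_im, hreal,
      zero_sub, ← RCLike.ofReal_pow]
    exact congrArg Neg.neg (Complex.im_mul_ofReal _ _)
  have hsq : |z.im| * ‖(u : L2)‖ * ‖(u : L2)‖ ≤ ‖shift (dirac κ) z u‖ * ‖(u : L2)‖ := by
    calc |z.im| * ‖(u : L2)‖ * ‖(u : L2)‖ = |(inner ℂ (u : L2) (shift (dirac κ) z u)).im| := by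
          rw [him, abs_neg, abs_mul, abs_sq, mul_assoc, sq]
      _ ≤ ‖shift (dirac κ) z u‖ * ‖(u : L2)‖ :=
        (Complex.abs_im_le_norm _).trans ((norm_inner_le_norm _ _).trans_eq (mul_comm _ _))
  rcases (norm_nonneg (u : L2)).eq_or_lt with hu | hu
  · rw [← hu, mul_zero]
    exact norm_nonneg _
  · exact le_of_mul_le_mul_right hsq hu

theorem isFredholmAt_dirac_of_norm_lt (hκ : Continuous κ) (hp : Tendsto κ atTop (𝓝 κp))
    (hm : Tendsto κ atBot (𝓝 κm)) (hzp : 2 / 3 * ‖z‖ < |κp|) (hzm : 2 / 3 * ‖z‖ < |κm|) :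
    IsFredholmAt (dirac κ) z := by
  obtain ⟨L, hL⟩ := exists_abs_le_of_tendsto hκ hp hm
  obtain ⟨C, hC⟩ := exists_norm_le hκ hp hm hzp hzm
  exact isFredholmAt_of_norm_le (by simpa only [dirac_graph] using isClosed_diracGraph hκ hL) hC
    (finiteDimensional_orthogonal_range_shift hκ hL z)

theorem isFredholmAt_dirac_of_im_ne_zero (hκ : Continuous κ) (hL : ∀ x, |κ x| ≤ L)
    (hz : z.im ≠ 0) : IsFredholmAt (dirac κ) z := by
  refine isFredholmAt_of_norm_le (ℓ := (0 : (dirac κ).domain →ₗ[ℂ] ℂ)) (C := |z.im|⁻¹)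
    (by simpa only [dirac_graph] using isClosed_diracGraph hκ hL) (fun u => ?_)
    (finiteDimensional_orthogonal_range_shift hκ hL z)
  rw [LinearMap.zero_apply, norm_zero, add_zero, ← div_eq_inv_mul,
    le_div_iff₀' (abs_pos.mpr hz)]
  exact abs_im_mul_norm_le u

end Fredholm

section Weyl

variable {κ : ℝ → ℝ} {k L : ℝ}

theorem exists_diracSymbol_eq_smul {E : ℝ} (hk : |k| ≤ 2 / 3 * |E|) : ∃ (ξ : ℝ) (v : Spinor),
    ‖v‖ = 1 ∧ diracSymbol k ((Complex.I * ξ) • v) v = (E : ℂ) • v := by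
  suffices ∃ (ξ : ℝ) (v : Spinor), v ≠ 0 ∧ diracSymbol k ((Complex.I * ξ) • v) v = (E : ℂ) • v by
    obtain ⟨ξ, v, hv, h⟩ := this
    refine ⟨ξ, ((‖v‖⁻¹ : ℝ) : ℂ) • v, by simp [norm_smul, hv], ?_⟩
    rw [smul_comm, smul_comm (E : ℂ), ← h]
    simp only [diracSymbol, map_smul, smul_add, smul_comm _ ((‖v‖⁻¹ : ℝ) : ℂ)]
  rcases eq_or_ne E 0 with rfl | hE
  · obtain rfl : k = 0 := by simpa using hk
    refine ⟨0, WithLp.toLp 2 ![1, 0], fun h => ?_, ?_⟩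
    · exact one_ne_zero (congrFun (congrArg WithLp.ofLp h) 0)
    · simp [diracSymbol]
  have hξ : 0 ≤ (2 / 3 * E) ^ 2 - k ^ 2 := by
    rw [sub_nonneg, sq_le_sq, abs_mul]
    simpa [abs_of_pos] using hk
  set ξ := √((2 / 3 * E) ^ 2 - k ^ 2)
  have hsq : (ξ : ℂ) ^ 2 = (2 / 3 * E) ^ 2 - k ^ 2 := by
    have h := congrArg Complex.ofReal (Real.sq_sqrt hξ)
    push_cast at h
    exact h
  refine ⟨ξ, WithLp.toLp 2 ![3 / 2 * (ξ - Complex.I * k), E], fun h => hE ?_, ?_⟩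
  · exact Complex.ofReal_eq_zero.mp (congrFun (congrArg WithLp.ofLp h) 1)
  ext i
  fin_cases i <;>
    simp only [Fin.zero_eta, Fin.mk_one, diracSymbol_apply_zero, diracSymbol_apply_one,
      PiLp.smul_apply, smul_eq_mul, Matrix.cons_val_zero, Matrix.cons_val_one]
  · linear_combination (-(3 / 2) * ξ * E) * Complex.I_sq
  · linear_combination
      (-(9 / 4) * (ξ - Complex.I * k) * ξ - 9 / 4 * k ^ 2) * Complex.I_sq + 9 / 4 * hsq

theorem diracSymbol_add_smul (l : ℝ) (a : ℂ) (w w' u : Spinor) :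
    diracSymbol (k + l) (w + a • w') (a • u) =
      diracSymbol l w (a • u) + a • diracSymbol k w' u := by
  simp only [diracSymbol, map_add, map_smul, Complex.ofReal_add]
  module

theorem norm_diracSymbol_le (w u : Spinor) :
    ‖diracSymbol k w u‖ ≤ 3 / 2 * (‖w‖ + |k| * ‖u‖) := by
  have h1 : ‖Matrix.toEuclideanLin pauli1 w‖ = ‖w‖ := by
    rw [← sq_eq_sq₀ (norm_nonneg _) (norm_nonneg _), norm_sq_eq_add, norm_sq_eq_add, add_comm]
    simp [pauli1, Matrix.toLpLin_apply, Matrix.vecHead, Matrix.vecTail]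
  have h2 : ‖Matrix.toEuclideanLin pauli2 u‖ = ‖u‖ := by
    rw [← sq_eq_sq₀ (norm_nonneg _) (norm_nonneg _), norm_sq_eq_add, norm_sq_eq_add, add_comm]
    simp [pauli2, Matrix.toLpLin_apply, Matrix.vecHead, Matrix.vecTail]
  rw [diracSymbol, norm_smul]
  norm_num
  refine (norm_add_le _ _).trans_eq ?_
  simp [norm_smul, h1, h2]

/-- A smooth cutoff function, equal to `1` near the origin and supported in `[-1, 1]`. -/
def cutoff : ContDiffBump (0 : ℝ) := ⟨1 / 2, 1, by norm_num, by norm_num⟩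

section Cutoff

variable {c r x : ℝ}

theorem cutoff_eq_zero (hr : 0 < r) (hx : r ≤ |x - c|) : cutoff ((x - c) / r) = 0 := by
  refine cutoff.zero_of_le_dist ?_
  rwa [Real.dist_0_eq_abs, abs_div, abs_of_pos hr, cutoff, le_div_iff₀ hr, one_mul]

theorem deriv_cutoff_eq_zero (hr : 0 < r) (hx : r < |x - c|) :
    deriv (fun x => cutoff ((x - c) / r)) x = 0 := by
  have hzero : (fun x => cutoff ((x - c) / r)) =ᶠ[𝓝 x] fun _ => 0 := by
    filter_upwards [(continuous_id.sub continuous_const).abs.continuousAt.eventually_const_lt hx]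
      with y hy using cutoff_eq_zero hr (le_of_lt hy)
  rw [hzero.deriv_eq, deriv_const]

theorem exists_abs_deriv_cutoff_le : ∃ C, ∀ {r : ℝ}, 0 < r → ∀ c x,
    |deriv (fun x => cutoff ((x - c) / r)) x| ≤ C / r := by
  obtain ⟨C, hC⟩ := cutoff.hasCompactSupport.deriv.exists_bound_of_continuous
    ((cutoff.contDiff (n := 1)).continuous_deriv le_rfl)
  refine ⟨C, fun {r} hr c x => ?_⟩
  have hd : HasDerivAt (fun x => cutoff ((x - c) / r)) (deriv cutoff ((x - c) / r) * (1 / r)) x :=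
    (((cutoff.contDiff (n := 1)).differentiable one_ne_zero _).hasDerivAt).comp x
      (((hasDerivAt_id x).sub_const c).div_const r)
  rw [hd.deriv, abs_mul, abs_of_pos (one_div_pos.mpr hr), mul_one_div]
  exact div_le_div_of_nonneg_right (hC _) hr.le

theorem integral_cutoff_sq (hr : 0 < r) :
    ∫ x, cutoff ((x - c) / r) ^ 2 = r * ∫ x, cutoff x ^ 2 := by
  rw [integral_sub_right_eq_self (fun x => cutoff (x / r) ^ 2),
    Measure.integral_comp_div (fun x => cutoff x ^ 2), abs_of_pos hr, smul_eq_mul]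

theorem integral_cutoff_sq_pos : 0 < ∫ x, cutoff x ^ 2 := by
  refine (cutoff.continuous.pow 2).integral_pos_of_hasCompactSupport_nonneg_nonzero
    (cutoff.hasCompactSupport.comp_left (g := (· ^ 2)) (zero_pow two_ne_zero))
    (fun x => sq_nonneg _) (x := 0) ?_
  exact pow_ne_zero 2 (cutoff.pos_of_mem_ball (Metric.mem_ball_self cutoff.rOut_pos)).ne'

end Cutoff

theorem norm_sq_le_of_ae_le {f : L2} {B c r : ℝ} (hr : 0 ≤ r)
    (hf : ∀ᵐ x, ‖f x‖ ≤ (Metric.closedBall c r).indicator (fun _ => B) x) :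
    ‖f‖ ^ 2 ≤ B ^ 2 * (2 * r) := by
  rw [norm_sq_eq_integral]
  calc ∫ x, ‖f x‖ ^ 2 ≤ ∫ x, (Metric.closedBall c r).indicator (fun _ => B ^ 2) x := by
        refine integral_mono_ae ((memLp_two_iff_integrable_sq_norm (Lp.memLp f).1).mp (Lp.memLp f))
          ((integrable_indicator_iff measurableSet_closedBall).mpr
            (integrableOn_const measure_closedBall_lt_top.ne)) (hf.mono fun x hx => ?_)
        refine (pow_le_pow_left₀ (norm_nonneg _) hx 2).trans_eq ?_
        by_cases hx' : x ∈ Metric.closedBall c r <;> simp [hx']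
    _ = B ^ 2 * (2 * r) := by
      rw [integral_indicator measurableSet_closedBall, setIntegral_const,
        Real.volume_real_closedBall hr, smul_eq_mul, mul_comm]

theorem exists_wavePacket (hκ : Continuous κ) (hL : ∀ x, |κ x| ≤ L) {E ξ : ℝ} {v : Spinor}
    (hv1 : ‖v‖ = 1) (hv : diracSymbol k ((Complex.I * ξ) • v) v = (E : ℂ) • v) {φ : ℝ → ℝ}
    (hφ : ContDiff ℝ 1 φ) (hsupp : HasCompactSupport φ) : ∃ u : (dirac κ).domain,
      (∀ᵐ x, ‖(u : L2) x‖ = |φ x|) ∧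
      ∀ᵐ x, ‖shift (dirac κ) E u x‖ ≤ 3 / 2 * (|deriv φ x| + |κ x - k| * |φ x|) := by
  set e : ℝ → ℂ := fun x => Complex.exp (Complex.I * ξ * x)
  have he (x : ℝ) : HasDerivAt e (Complex.I * ξ * e x) x := by
    have := (((hasDerivAt_id x).ofReal_comp).const_mul (Complex.I * ξ)).cexp
    simpa [mul_comm, e] using this
  have hnorm (x : ℝ) : ‖e x‖ = 1 := by
    rw [Complex.norm_exp]
    simp
  have hec : Continuous e := by fun_prop
  set U : ℝ → Spinor := fun x => ((φ x : ℂ) * e x) • v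
  set W : ℝ → Spinor := fun x => (deriv φ x * e x + φ x * (Complex.I * ξ * e x)) • v
  have hUW (x : ℝ) : HasDerivAt U (W x) x :=
    ((((hφ.differentiable one_ne_zero) x).hasDerivAt.ofReal_comp).mul (he x)).smul_const v
  have hφc := hφ.continuous
  have _ := hφ.continuous_deriv le_rfl
  have hUc : Continuous U := by fun_prop
  have hWc : Continuous W := by fun_prop
  have hUs : HasCompactSupport U := hsupp.mono fun x hx => by
    contrapose! hx
    simp_all [U]
  have hWs : HasCompactSupport W := (funext fun x => (hUW x).deriv : deriv U = W) ▸ hUs.deriv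
  obtain ⟨u, f, huf, hu, hf⟩ := exists_mem_diracGraph hκ hL (.of_hasDerivAt hWc hUW)
    (hUc.memLp_of_hasCompactSupport hUs) (hWc.memLp_of_hasCompactSupport hWs)
  have hsymbol (x : ℝ) : diracSymbol (κ x) (W x) (U x) =
      diracSymbol (κ x - k) ((deriv φ x * e x) • v) (U x) + (E : ℂ) • U x := by
    rw [smul_comm, ← hv, ← diracSymbol_add_smul]
    simp only [U, W, add_sub_cancel]
    congr 1
    module
  rw [← dirac_graph] at huf
  obtain ⟨u, rfl, hshift⟩ := exists_shift_eq_of_mem_graph (z := (E : ℂ)) huf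
  refine ⟨u, hu.mono fun x hx => by simp [hx, U, norm_smul, hnorm, hv1], ?_⟩
  rw [hshift]
  filter_upwards [hu, hf, Lp.coeFn_sub f ((E : ℂ) • (u : L2)), Lp.coeFn_smul (E : ℂ) (u : L2)]
    with x hu hf hsub hsmul
  rw [hsub, Pi.sub_apply, hsmul, Pi.smul_apply, hf, hu, hsymbol, add_sub_cancel_right]
  refine (norm_diracSymbol_le _ _).trans_eq ?_
  simp [U, norm_smul, hnorm, hv1]

theorem exists_approx_eigenfunction (hκ : Continuous κ) (hL : ∀ x, |κ x| ≤ L) {E : ℝ}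
    (hk : |k| ≤ 2 / 3 * |E|) : ∃ C K : ℝ, ∀ r c ε, 0 < r → (∀ x, |x - c| ≤ r → |κ x - k| ≤ ε) →
      ∃ u : (dirac κ).domain, ‖(u : L2)‖ = 1 ∧ (∀ᵐ x, r < |x - c| → (u : L2) x = 0) ∧
        ‖shift (dirac κ) E u‖ ^ 2 ≤ K * (C / r + ε) ^ 2 := by
  obtain ⟨ξ, v, hv1, hv⟩ := exists_diracSymbol_eq_smul hk
  obtain ⟨C, hC⟩ := exists_abs_deriv_cutoff_le
  set I₀ := ∫ x, cutoff x ^ 2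
  have hI₀ : 0 < I₀ := integral_cutoff_sq_pos
  refine ⟨C, 9 / 2 / I₀, fun r c ε hr hε => ?_⟩
  set φ : ℝ → ℝ := fun x => cutoff ((x - c) / r)
  have hφ : ContDiff ℝ 1 φ := cutoff.contDiff.comp (by fun_prop)
  have hzero {x : ℝ} (hx : x ∉ Metric.closedBall c r) : φ x = 0 ∧ deriv φ x = 0 := by
    rw [Metric.mem_closedBall, Real.dist_eq, not_le] at hx
    exact ⟨cutoff_eq_zero hr hx.le, deriv_cutoff_eq_zero hr hx⟩
  obtain ⟨u, hu, hshift⟩ := exists_wavePacket hκ hL hv1 hv hφ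
    (.intro (isCompact_closedBall c r) fun x hx => (hzero hx).1)
  have hnorm : ‖(u : L2)‖ ^ 2 = r * I₀ := by
    rw [norm_sq_eq_integral, ← integral_cutoff_sq hr (c := c)]
    exact integral_congr_ae (hu.mono fun x hx => by simp only [hx, sq_abs, φ])
  have hbound : ‖shift (dirac κ) E u‖ ^ 2 ≤ (3 / 2 * (C / r + ε)) ^ 2 * (2 * r) := by
    refine norm_sq_le_of_ae_le (c := c) hr.le (hshift.mono fun x hx => hx.trans ?_)
    by_cases hxr : x ∈ Metric.closedBall c r
    · have hφ1 : |φ x| ≤ 1 := (abs_of_nonneg cutoff.nonneg).trans_le cutoff.le_one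
      have hκx := hε x (by rwa [Metric.mem_closedBall, Real.dist_eq] at hxr)
      rw [indicator_of_mem hxr]
      gcongr
      · exact hC hr c x
      · exact (mul_le_of_le_one_right (abs_nonneg _) hφ1).trans hκx
    · simp [hzero hxr, hxr]
  have hpos : 0 < ‖(u : L2)‖ := by
    refine (norm_nonneg _).lt_of_ne fun h => ?_
    rw [← h] at hnorm
    linarith [mul_pos hr hI₀]
  refine ⟨((‖(u : L2)‖⁻¹ : ℝ) : ℂ) • u, ?_, ?_, ?_⟩
  · simp [norm_smul, hpos.ne']
  · filter_upwards [Lp.coeFn_smul ((‖(u : L2)‖⁻¹ : ℝ) : ℂ) (u : L2), hu] with x hx hux hxr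
    have hφx : φ x = 0 := cutoff_eq_zero hr hxr.le
    rw [hφx, abs_zero, norm_eq_zero] at hux
    rw [Submodule.coe_smul, hx, Pi.smul_apply, hux, smul_zero]
  · rw [map_smul, norm_smul, mul_pow, Complex.norm_real, norm_inv, norm_norm, inv_pow, hnorm,
      inv_mul_le_iff₀ (mul_pos hr hI₀)]
    refine hbound.trans_eq ?_
    field_simp
    ring

theorem tendsto_inner_of_ae_eq_zero {u : ℕ → L2} (hu : ∀ n, ‖u n‖ = 1)
    (hsupp : ∀ n : ℕ, ∀ᵐ x : ℝ, |x| < n → u n x = 0) (v : L2) :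
    Tendsto (fun n => inner ℂ v (u n)) atTop (𝓝 0) := by
  set s : ℕ → Set ℝ := fun n => {x | (n : ℝ) ≤ |x|}
  have hs (n : ℕ) : MeasurableSet (s n) := measurableSet_le measurable_const measurable_norm
  set V : ℕ → L2 := fun n => ((Lp.memLp v).indicator (hs n)).toLp _
  have hV (n : ℕ) : V n =ᵐ[volume] (s n).indicator v := MemLp.coeFn_toLp _
  have hinner (n : ℕ) : inner ℂ v (u n) = inner ℂ (V n) (u n) := by
    rw [L2.inner_def, L2.inner_def]
    refine integral_congr_ae ?_
    filter_upwards [hsupp n, hV n] with x hx hVx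
    by_cases hxs : x ∈ s n
    · rw [hVx, indicator_of_mem hxs]
    · rw [hx (not_le.mp hxs), inner_zero_right, inner_zero_right]
  have hnormV : Tendsto (fun n => ‖V n‖ ^ 2) atTop (𝓝 0) := by
    simp only [norm_sq_eq_integral]
    rw [← integral_zero ℝ ℝ]
    refine tendsto_integral_of_dominated_convergence (fun x => ‖v x‖ ^ 2)
      (fun n => (Lp.memLp (V n)).1.norm.pow 2)
      ((memLp_two_iff_integrable_sq_norm (Lp.memLp v).1).mp (Lp.memLp v)) (fun n => ?_) ?_
    · filter_upwards [hV n] with x hx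
      rw [hx, Real.norm_eq_abs, abs_sq]
      gcongr
      exact norm_indicator_le_norm_self _ _
    · filter_upwards [ae_all_iff.mpr hV] with x hx
      refine tendsto_const_nhds.congr' ?_
      filter_upwards [tendsto_natCast_atTop_atTop.eventually_gt_atTop |x|] with n hn
      rw [hx n, indicator_of_notMem (show x ∉ s n from not_le.mpr hn)]
      simp
  have hV0 : Tendsto (fun n => ‖V n‖) atTop (𝓝 0) := by
    simpa using hnormV.sqrt
  refine squeeze_zero_norm (fun n => ?_) hV0
  rw [hinner]
  simpa [hu n] using norm_inner_le_norm (𝕜 := ℂ) (V n) (u n)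

theorem exists_forall_abs_sub_le_of_tendsto (h : Tendsto κ atTop (𝓝 k) ∨ Tendsto κ atBot (𝓝 k))
    (r R : ℝ) {ε : ℝ} (hε : 0 < ε) :
    ∃ c, R ≤ |c| ∧ ∀ x, |x - c| ≤ r → |κ x - k| ≤ ε := by
  rcases h with h | h
  · obtain ⟨N, hN⟩ := eventually_atTop.mp (h.eventually (Metric.closedBall_mem_nhds k hε))
    refine ⟨max R (N + r), (le_max_left _ _).trans (le_abs_self _), fun x hx => hN x ?_⟩
    linarith [(abs_le.mp hx).1, le_max_right R (N + r)]
  · obtain ⟨N, hN⟩ := eventually_atBot.mp (h.eventually (Metric.closedBall_mem_nhds k hε))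
    refine ⟨min (-R) (N - r), ?_, fun x hx => hN x ?_⟩
    · exact (le_neg_of_le_neg (min_le_left _ _)).trans (neg_le_abs _)
    · linarith [(abs_le.mp hx).2, min_le_right (-R) (N - r)]

theorem not_isFredholmAt_dirac (hκ : Continuous κ) (hL : ∀ x, |κ x| ≤ L)
    (h : Tendsto κ atTop (𝓝 k) ∨ Tendsto κ atBot (𝓝 k)) {E : ℝ} (hk : |k| ≤ 2 / 3 * |E|) :
    ¬ IsFredholmAt (dirac κ) E := by
  obtain ⟨C, K, hCK⟩ := exists_approx_eigenfunction hκ hL hk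
  have hpos (n : ℕ) : (0 : ℝ) < n + 1 := n.cast_add_one_pos
  choose c hc hκc using fun n : ℕ =>
    exists_forall_abs_sub_le_of_tendsto h (n + 1) (2 * n + 1) (one_div_pos.mpr (hpos n))
  choose u hu hsupp hshift using fun n : ℕ => hCK _ (c n) _ (hpos n) (hκc n)
  refine not_isFredholmAt_of_tendsto (u := u)
    (by simpa only [dirac_graph] using isClosed_diracGraph hκ hL) hu
    (tendsto_inner_of_ae_eq_zero hu fun n => (hsupp n).mono fun x hx hxn => hx ?_) ?_
  · linarith [hc n, abs_sub_abs_le_abs_sub (c n) x, abs_sub_comm (c n) x]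
  · have hlim : Tendsto (fun n : ℕ => K * (C / (n + 1) + 1 / ((n : ℝ) + 1)) ^ 2) atTop (𝓝 0) := by
      simpa [div_eq_mul_inv] using ((((tendsto_one_div_add_atTop_nhds_zero_nat (𝕜 := ℝ)).const_mul
        C).add tendsto_one_div_add_atTop_nhds_zero_nat).pow 2).const_mul K
    have hsq := squeeze_zero (fun n => sq_nonneg _) hshift hlim
    exact tendsto_zero_iff_norm_tendsto_zero.mpr (by simpa using hsq.sqrt)

theorem isFredholmAt_dirac_ofReal_iff (hκ : Continuous κ) {κp κm : ℝ}
    (hp : Tendsto κ atTop (𝓝 κp)) (hm : Tendsto κ atBot (𝓝 κm)) {E : ℝ} :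
    IsFredholmAt (dirac κ) E ↔ |E| < 3 / 2 * min |κp| |κm| := by
  obtain ⟨L, hL⟩ := exists_abs_le_of_tendsto hκ hp hm
  constructor
  · intro h
    by_contra! hE
    rcases min_choice |κp| |κm| with hmin | hmin <;> rw [hmin] at hE
    · exact not_isFredholmAt_dirac hκ hL (.inl hp) (by linarith) h
    · exact not_isFredholmAt_dirac hκ hL (.inr hm) (by linarith) h
  · intro hE
    have hnorm : ‖(E : ℂ)‖ = |E| := Complex.norm_real E
    exact isFredholmAt_dirac_of_norm_lt hκ hp hm (by linarith [min_le_left |κp| |κm|])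
      (by linarith [min_le_right |κp| |κm|])

theorem essentialSpectrum_dirac (hκ : Continuous κ) {κp κm : ℝ} (hp : Tendsto κ atTop (𝓝 κp))
    (hm : Tendsto κ atBot (𝓝 κm)) : essentialSpectrum (dirac κ) = Complex.ofReal ''
      (Iic (-(3 / 2 * min |κp| |κm|)) ∪ Ici (3 / 2 * min |κp| |κm|)) := by
  obtain ⟨L, hL⟩ := exists_abs_le_of_tendsto hκ hp hm
  have hmem (E : ℝ) : (E : ℂ) ∈ essentialSpectrum (dirac κ) ↔
      E ∈ Iic (-(3 / 2 * min |κp| |κm|)) ∪ Ici (3 / 2 * min |κp| |κm|) := by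
    refine (not_congr (isFredholmAt_dirac_ofReal_iff hκ hp hm)).trans ?_
    rw [not_lt, le_abs', mem_union, mem_Iic, mem_Ici]
  ext z
  constructor
  · intro hz
    have him : z.im = 0 := not_not.mp fun h => hz (isFredholmAt_dirac_of_im_ne_zero hκ hL h)
    obtain ⟨E, rfl⟩ : ∃ E : ℝ, (E : ℂ) = z := ⟨z.re, Complex.ext rfl him.symm⟩
    exact ⟨E, (hmem E).mp hz, rfl⟩
  · rintro ⟨E, hE, rfl⟩
    exact (hmem E).mpr hE

end Weyl

section Asymptotics

theorem nonpos_of_monotoneOn_of_integrableOn {F : ℝ → ℝ} {N x : ℝ} (hF : MonotoneOn F (Ici N))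
    (hint : Integrable F) (hx : N ≤ x) : F x ≤ 0 := by
  by_contra! hpos
  have hconst : IntegrableOn (fun _ => F x) (Ici x) := by
    refine (hint.integrableOn (s := Ici x)).mono' aestronglyMeasurable_const ?_
    filter_upwards [ae_restrict_mem measurableSet_Ici] with y hy
    rw [Real.norm_eq_abs, abs_of_pos hpos]
    exact hF hx (hx.trans hy) hy
  rw [integrableOn_const_iff] at hconst
  simp [hpos.ne'] at hconst

theorem exists_tendsto_of_abs_deriv_le {f f' β : ℝ → ℝ} (hβ : IntegrableOn β (Ioi 0))
    (h : ∀ᶠ x in atTop, HasDerivAt f (f' x) x ∧ |f' x| ≤ β x) :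
    ∃ l, Tendsto f atTop (𝓝 l) := by
  obtain ⟨N, hN⟩ := eventually_atTop.mp (h.and (eventually_ge_atTop 0))
  have hderiv (x : ℝ) (hx : x ∈ Ioi N) : HasDerivAt f (deriv f x) x :=
    (hN x (le_of_lt hx)).1.1.differentiableAt.hasDerivAt
  refine ⟨_, tendsto_limUnder_of_hasDerivAt_of_integrableOn_Ioi hderiv
    ((hβ.mono_set (Ioi_subset_Ioi (hN N le_rfl).2)).mono' (aestronglyMeasurable_deriv f _) ?_)⟩
  filter_upwards [ae_restrict_mem measurableSet_Ioi] with x hx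
  rw [(hN x (le_of_lt hx)).1.1.deriv]
  exact (hN x (le_of_lt hx)).1.2

theorem exists_tendsto_ne_zero_of_abs_deriv_le {f f' β : ℝ → ℝ} (hβ : IntegrableOn β (Ioi 0))
    (h : ∀ᶠ x in atTop, HasDerivAt f (f' x) x ∧ |f' x| ≤ β x * |f x| ∧ f x ≠ 0) :
    ∃ l ≠ 0, Tendsto f atTop (𝓝 l) := by
  obtain ⟨ℓ, hℓ⟩ : ∃ ℓ, Tendsto (fun x => Real.log (f x)) atTop (𝓝 ℓ) := by
    refine exists_tendsto_of_abs_deriv_le (f' := fun x => f' x / f x) hβ (h.mono fun x hx => ?_)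
    refine ⟨hx.1.log hx.2.2, ?_⟩
    rw [abs_div, div_le_iff₀ (abs_pos.mpr hx.2.2)]
    exact hx.2.1
  have habs : Tendsto (fun x => |f x|) atTop (𝓝 (Real.exp ℓ)) :=
    ((Real.continuous_exp.tendsto ℓ).comp hℓ).congr' (h.mono fun x hx => Real.exp_log_eq_abs hx.2.2)
  obtain ⟨l, hl⟩ : ∃ l, Tendsto f atTop (𝓝 l) := by
    refine exists_tendsto_of_abs_deriv_le (f' := f') (hβ.mul_const (Real.exp ℓ + 1)) ?_
    filter_upwards [h, habs.eventually_le_const (lt_add_one _)] with x hx hle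
    have hβ0 : 0 ≤ β x :=
      nonneg_of_mul_nonneg_left ((abs_nonneg _).trans hx.2.1) (abs_pos.mpr hx.2.2)
    exact ⟨hx.1, hx.2.1.trans (mul_le_mul_of_nonneg_left hle hβ0)⟩
  refine ⟨l, fun h0 => (Real.exp_pos ℓ).ne' ?_, hl⟩
  simpa [h0] using tendsto_nhds_unique habs hl.abs

variable {Y Z f g β : ℝ → ℝ} {μ : ℝ}

/-- In the dichotomy `Y' ≈ -μ Y`, `Z' ≈ μ Z`, the form `Z² - δ² Y²` is eventually increasing. -/
theorem eventually_deriv_cone_nonneg (hμ : 0 < μ) (hβ0 : ∀ x, 0 ≤ β x) (hβ : Tendsto β atTop (𝓝 0))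
    (hf : ∀ x, |f x| ≤ β x * (|Y x| + |Z x|)) (hg : ∀ x, |g x| ≤ β x * (|Y x| + |Z x|))
    {δ : ℝ} (hδ : 0 < δ) : ∀ᶠ x in atTop,
      0 ≤ 2 * Z x * (μ * Z x + g x) - δ ^ 2 * (2 * Y x * (-(μ * Y x) + f x)) := by
  have hη : 0 < 2 * δ * μ / (1 + δ) ^ 2 := by positivity
  filter_upwards [hβ.eventually_le_const hη] with x hx
  rw [le_div_iff₀ (by positivity)] at hx
  set y := |Y x|
  set z := |Z x|
  have hy : 0 ≤ y := abs_nonneg _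
  have hz : 0 ≤ z := abs_nonneg _
  have hZg : -(z * (β x * (y + z))) ≤ Z x * g x := by
    refine (neg_le_neg ?_).trans (neg_abs_le _)
    rw [abs_mul]
    exact mul_le_mul_of_nonneg_left (hg x) hz
  have hYf : Y x * f x ≤ y * (β x * (y + z)) := by
    refine (le_abs_self _).trans ?_
    rw [abs_mul]
    exact mul_le_mul_of_nonneg_left (hf x) hy
  have hcone : 2 * δ * ((z + δ ^ 2 * y) * (y + z)) ≤ (1 + δ) ^ 2 * (z ^ 2 + δ ^ 2 * y ^ 2) := by
    nlinarith [sq_nonneg (z - δ * y), sq_nonneg (1 - δ), mul_nonneg hy hz]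
  have herror : β x * ((z + δ ^ 2 * y) * (y + z)) ≤ μ * (z ^ 2 + δ ^ 2 * y ^ 2) := by
    have hsq : 0 ≤ z ^ 2 + δ ^ 2 * y ^ 2 := by positivity
    refine le_of_mul_le_mul_left ?_ (mul_pos two_pos hδ)
    linarith [mul_le_mul_of_nonneg_left hcone (hβ0 x), mul_le_mul_of_nonneg_right hx hsq]
  rw [sq_abs, sq_abs] at herror
  linarith [mul_le_mul_of_nonneg_left hYf (sq_nonneg δ)]

theorem isLittleO_of_memLp (hμ : 0 < μ) (hβ0 : ∀ x, 0 ≤ β x) (hβ : Tendsto β atTop (𝓝 0))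
    (hY : ∀ x, HasDerivAt Y (-(μ * Y x) + f x) x) (hZ : ∀ x, HasDerivAt Z (μ * Z x + g x) x)
    (hf : ∀ x, |f x| ≤ β x * (|Y x| + |Z x|)) (hg : ∀ x, |g x| ≤ β x * (|Y x| + |Z x|))
    (hY2 : MemLp Y 2) (hZ2 : MemLp Z 2) : Z =o[atTop] Y := by
  rw [Asymptotics.isLittleO_iff]
  intro δ hδ
  obtain ⟨N, hN⟩ := eventually_atTop.mp (eventually_deriv_cone_nonneg hμ hβ0 hβ hf hg hδ)
  have hd (x : ℝ) : HasDerivAt (fun x => Z x ^ 2 - δ ^ 2 * Y x ^ 2)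
      (2 * Z x * (μ * Z x + g x) - δ ^ 2 * (2 * Y x * (-(μ * Y x) + f x))) x := by
    simpa using ((hZ x).fun_pow 2).fun_sub (((hY x).fun_pow 2).const_mul (δ ^ 2))
  have hmono : MonotoneOn (fun x => Z x ^ 2 - δ ^ 2 * Y x ^ 2) (Ici N) := by
    refine monotoneOn_of_deriv_nonneg (convex_Ici N)
      (fun x _ => (hd x).continuousAt.continuousWithinAt)
      (fun x _ => (hd x).differentiableAt.differentiableWithinAt) fun x hx => ?_
    rw [(hd x).deriv]
    exact hN x (interior_subset hx)
  filter_upwards [eventually_ge_atTop N] with x hx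
  have hle := nonpos_of_monotoneOn_of_integrableOn hmono
    (hZ2.integrable_sq.sub (hY2.integrable_sq.const_mul _)) hx
  rw [← mul_pow, sub_nonpos, sq_le_sq, abs_mul, abs_of_pos hδ] at hle
  exact hle

theorem exists_tendsto_exp_mul (hβ0 : ∀ x, 0 ≤ β x) (hβ : IntegrableOn β (Ioi 0))
    (hY : ∀ x, HasDerivAt Y (-(μ * Y x) + f x) x)
    (hf : ∀ x, |f x| ≤ β x * (|Y x| + |Z x|))
    (hne : ∀ x, Y x ≠ 0 ∨ Z x ≠ 0) (hZY : Z =o[atTop] Y) :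
    (∃ w ≠ 0, Tendsto (fun x => Real.exp (μ * x) * Y x) atTop (𝓝 w)) ∧
      Tendsto (fun x => Real.exp (μ * x) * Z x) atTop (𝓝 0) := by
  have hexp (x : ℝ) : HasDerivAt (fun x => Real.exp (μ * x)) (Real.exp (μ * x) * μ) x := by
    simpa using ((hasDerivAt_id x).const_mul μ).exp
  obtain ⟨w, hw, hlim⟩ : ∃ w ≠ 0, Tendsto (fun x => Real.exp (μ * x) * Y x) atTop (𝓝 w) := by
    refine exists_tendsto_ne_zero_of_abs_deriv_le (f' := fun x => Real.exp (μ * x) * f x)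
      (hβ.const_mul 2) ?_
    filter_upwards [hZY.bound one_pos] with x hx
    rw [one_mul, Real.norm_eq_abs, Real.norm_eq_abs] at hx
    refine ⟨((hexp x).mul (hY x)).congr_deriv (by ring), ?_, ?_⟩
    · rw [abs_mul, abs_mul, Real.abs_exp, mul_left_comm]
      gcongr
      nlinarith [hf x, hβ0 x]
    · refine mul_ne_zero (Real.exp_ne_zero _) fun h0 => (hne x).elim (· h0) fun hZ => hZ ?_
      simpa [h0] using hx
  refine ⟨⟨w, hw, hlim⟩, ?_⟩
  exact (((Asymptotics.isBigO_refl (fun x => Real.exp (μ * x)) atTop).mul_isLittleO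
    hZY).trans_isBigO (hlim.isBigO_one ℝ)).tendsto_zero_of_tendsto tendsto_const_nhds

theorem exists_abs_add_abs_le {m b c : ℝ} (hD : m ^ 2 + b * c ≠ 0) :
    ∃ K, 0 ≤ K ∧ ∀ p q : ℝ, |p| + |q| ≤ K * (|m * q - c * p| + |m * p + b * q|) := by
  set D := m ^ 2 + b * c with hDdef
  refine ⟨(|m| + |b| + |c|) / |D|, by positivity, fun p q => ?_⟩
  set Y := m * q - c * p with hY
  set Z := m * p + b * q with hZ
  have hp : |D| * |p| ≤ |m| * |Z| + |b| * |Y| := by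
    rw [← abs_mul, ← abs_mul, ← abs_mul, show D * p = m * Z - b * Y by rw [hDdef, hY, hZ]; ring]
    exact abs_sub _ _
  have hq : |D| * |q| ≤ |m| * |Y| + |c| * |Z| := by
    rw [← abs_mul, ← abs_mul, ← abs_mul, show D * q = m * Y + c * Z by rw [hDdef, hY, hZ]; ring]
    exact abs_add_le _ _
  rw [div_mul_eq_mul_div, le_div_iff₀ (abs_pos.mpr hD)]
  have := mul_nonneg (abs_nonneg b) (abs_nonneg Z)
  have := mul_nonneg (abs_nonneg c) (abs_nonneg Y)
  linarith

theorem abs_mul_add_mul_le {A B M p q : ℝ} (hA : |A| ≤ M) (hB : |B| ≤ M) :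
    |A * p + B * q| ≤ M * (|p| + |q|) := by
  refine (abs_add_le _ _).trans ?_
  rw [abs_mul, abs_mul, mul_add]
  gcongr

theorem add_ne_zero_of_sq_eq {b c k s : ℝ} (hk : 0 ≤ k) (hs : 0 < s)
    (hsq : s ^ 2 = k ^ 2 + b * c) : (k + s) ^ 2 + b * c ≠ 0 := by
  rw [show (k + s) ^ 2 + b * c = 2 * s * (k + s) by linarith]
  positivity

namespace IsSol

variable {κ p q : ℝ → ℝ} {b c : ℝ}

theorem swap (h : IsSol κ b c p q) : IsSol (fun x => -κ x) c b q p where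
  fst x := (h.snd x).congr_deriv (by simp only [neg_smul]; ring)
  snd x := (h.fst x).congr_deriv (by simp only [neg_smul]; ring)

theorem hasDerivAt_decaying {k s : ℝ} (h : IsSol κ b c p q) (hsq : s ^ 2 = k ^ 2 + b * c) (x : ℝ) :
    HasDerivAt (fun x => (k + s) * q x - c * p x) (-(s * ((k + s) * q x - c * p x)) +
      (κ x - k) * (-c * p x + -(k + s) * q x)) x := by
  refine (((h.snd x).const_mul (k + s)).sub ((h.fst x).const_mul c)).congr_deriv ?_
  simp only [smul_eq_mul]
  linear_combination q x * hsq

theorem hasDerivAt_growing {k s : ℝ} (h : IsSol κ b c p q) (hsq : s ^ 2 = k ^ 2 + b * c) (x : ℝ) :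
    HasDerivAt (fun x => (k + s) * p x + b * q x) (s * ((k + s) * p x + b * q x) +
      (κ x - k) * ((k + s) * p x + -b * q x)) x := by
  refine (((h.fst x).const_mul (k + s)).add ((h.snd x).const_mul b)).congr_deriv ?_
  simp only [smul_eq_mul]
  linear_combination (-p x) * hsq

/-- The coordinates `(k + s) q - c p` and `(k + s) p + b q` diagonalise the limiting system at
`+∞`, whose rates are `∓s`. -/
theorem tendsto_exp_mul_eigencoordinates {k s L : ℝ} (h : IsSol κ b c p q) (hL : ∀ x, |κ x| ≤ L)
    (hκ : Tendsto κ atTop (𝓝 k)) (hi : IntegrableOn (fun x => κ x - k) (Ioi 0)) (hk : 0 ≤ k)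
    (hs : 0 < s) (hsq : s ^ 2 = k ^ 2 + b * c) (hp : MemLp p 2) (hq : MemLp q 2)
    (h0 : p 0 ≠ 0 ∨ q 0 ≠ 0) :
    (∃ w ≠ 0, Tendsto (fun x => Real.exp (s * x) * ((k + s) * q x - c * p x)) atTop (𝓝 w)) ∧
      Tendsto (fun x => Real.exp (s * x) * ((k + s) * p x + b * q x)) atTop (𝓝 0) := by
  set m := k + s
  set M := |m| + |b| + |c|
  obtain ⟨K, hK, hbound⟩ := exists_abs_add_abs_le (add_ne_zero_of_sq_eq hk hs hsq)
  set β : ℝ → ℝ := fun x => |κ x - k| * (M * K)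
  have hβ0 (x : ℝ) : 0 ≤ β x := by positivity
  have hβ : Tendsto β atTop (𝓝 0) := by
    simpa [β] using (hκ.sub_const k).abs.mul_const (M * K)
  have herror (A B : ℝ) (hA : |A| ≤ M) (hB : |B| ≤ M) (x : ℝ) :
      |(κ x - k) * (A * p x + B * q x)| ≤
        β x * (|m * q x - c * p x| + |m * p x + b * q x|) := by
    rw [abs_mul, mul_assoc, mul_assoc]
    gcongr
    exact (abs_mul_add_mul_le hA hB).trans (mul_le_mul_of_nonneg_left (hbound _ _) (by positivity))
  have hm0 := abs_nonneg m
  have hb0 := abs_nonneg b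
  have hc0 := abs_nonneg c
  have hf := herror (-c) (-m) (by rw [abs_neg]; linarith) (by rw [abs_neg]; linarith)
  have hg := herror m (-b) (by linarith) (by rw [abs_neg]; linarith)
  refine exists_tendsto_exp_mul hβ0 (hi.abs.mul_const (M * K)) (h.hasDerivAt_decaying hsq) hf
    (fun x => ?_) (isLittleO_of_memLp hs hβ0 hβ (h.hasDerivAt_decaying hsq)
      (h.hasDerivAt_growing hsq) hf hg ((hq.const_mul m).sub (hp.const_mul c))
      ((hp.const_mul m).add (hq.const_mul b)))
  by_contra! hzero
  have hpq := hbound (p x) (q x)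
  rw [hzero.1, hzero.2, abs_zero, add_zero, mul_zero] at hpq
  have hpx : p x = 0 := abs_nonpos_iff.mp (by linarith [abs_nonneg (q x)])
  have hqx : q x = 0 := abs_nonpos_iff.mp (by linarith [abs_nonneg (p x)])
  have hpq0 := h.eq_zero hL hpx hqx 0
  exact h0.elim (· hpq0.1) (· hpq0.2)

theorem exists_tendsto_exp_mul_of_nonneg {k s L : ℝ} (h : IsSol κ b c p q) (hL : ∀ x, |κ x| ≤ L)
    (hκ : Tendsto κ atTop (𝓝 k)) (hi : IntegrableOn (fun x => κ x - k) (Ioi 0)) (hk : 0 ≤ k)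
    (hs : 0 < s) (hsq : s ^ 2 = k ^ 2 + b * c) (hp : MemLp p 2) (hq : MemLp q 2)
    (h0 : p 0 ≠ 0 ∨ q 0 ≠ 0) : ∃ P Q : ℝ, (P ≠ 0 ∨ Q ≠ 0) ∧
      Tendsto (fun x => Real.exp (s * x) * p x) atTop (𝓝 P) ∧
      Tendsto (fun x => Real.exp (s * x) * q x) atTop (𝓝 Q) := by
  have hD := add_ne_zero_of_sq_eq hk hs hsq
  have hm : k + s ≠ 0 := by positivity
  obtain ⟨⟨w, hw, hY⟩, hZ⟩ := h.tendsto_exp_mul_eigencoordinates hL hκ hi hk hs hsq hp hq h0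
  refine ⟨_, _, .inr ?_,
    (((hZ.const_mul (k + s)).sub (hY.const_mul b)).div_const ((k + s) ^ 2 + b * c)).congr
      fun x => ?_,
    (((hY.const_mul (k + s)).add (hZ.const_mul c)).div_const ((k + s) ^ 2 + b * c)).congr
      fun x => ?_⟩
  · simp [hm, hw, hD]
  · rw [div_eq_iff hD]
    ring
  · rw [div_eq_iff hD]
    ring

theorem exists_tendsto_exp_mul_atTop {k L : ℝ} (h : IsSol κ b c p q) (hL : ∀ x, |κ x| ≤ L)
    (hκ : Tendsto κ atTop (𝓝 k)) (hi : IntegrableOn (fun x => κ x - k) (Ioi 0))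
    (hbc : 0 < k ^ 2 + b * c) (hp : MemLp p 2) (hq : MemLp q 2) (h0 : p 0 ≠ 0 ∨ q 0 ≠ 0) :
    ∃ s > 0, ∃ P Q : ℝ, (P ≠ 0 ∨ Q ≠ 0) ∧
      Tendsto (fun x => Real.exp (s * x) * p x) atTop (𝓝 P) ∧
      Tendsto (fun x => Real.exp (s * x) * q x) atTop (𝓝 Q) := by
  have hs : 0 < √(k ^ 2 + b * c) := Real.sqrt_pos.mpr hbc
  have hsq := Real.sq_sqrt hbc.le
  refine ⟨_, hs, ?_⟩
  rcases le_total 0 k with hk | hk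
  · exact h.exists_tendsto_exp_mul_of_nonneg hL hκ hi hk hs hsq hp hq h0
  · obtain ⟨Q, P, hne, hQ, hP⟩ := h.swap.exists_tendsto_exp_mul_of_nonneg (k := -k)
      (fun x => (abs_neg (κ x)).trans_le (hL x)) hκ.neg
      (hi.neg.congr_fun (fun x _ => by simp; ring) measurableSet_Ioi) (neg_nonneg.mpr hk) hs
      (by rw [hsq]; ring) hq hp h0.symm
    exact ⟨P, Q, hne.symm, hP, hQ⟩

theorem exists_tendsto_exp_mul_atBot {k L : ℝ} (h : IsSol κ b c p q) (hL : ∀ x, |κ x| ≤ L)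
    (hκ : Tendsto κ atBot (𝓝 k)) (hi : IntegrableOn (fun x => κ x - k) (Iio 0))
    (hbc : 0 < k ^ 2 + b * c) (hp : MemLp p 2) (hq : MemLp q 2) (h0 : p 0 ≠ 0 ∨ q 0 ≠ 0) :
    ∃ s < 0, ∃ P Q : ℝ, (P ≠ 0 ∨ Q ≠ 0) ∧
      Tendsto (fun x => Real.exp (s * x) * p x) atBot (𝓝 P) ∧
      Tendsto (fun x => Real.exp (s * x) * q x) atBot (𝓝 Q) := by
  have hneg := Measure.measurePreserving_neg (volume : Measure ℝ)
  have hi' : IntegrableOn (fun x => -κ (-x) - -k) (Ioi 0) := by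
    have hcomp := hi.comp_neg.neg
    rw [Set.neg_Iio, neg_zero] at hcomp
    exact hcomp.congr_fun (fun x _ => by simp; ring) measurableSet_Ioi
  obtain ⟨s, hs, P, Q, hne, hP, hQ⟩ := h.comp_neg.exists_tendsto_exp_mul_atTop (L := L)
    (fun x => (abs_neg (κ (-x))).trans_le (hL (-x))) (hκ.comp tendsto_neg_atTop_atBot).neg hi'
    (by simpa using hbc) (hp.comp_measurePreserving hneg) (hq.comp_measurePreserving hneg)
    (by simpa using h0)
  exact ⟨-s, neg_neg_of_pos hs, P, Q, hne,
    (hP.comp tendsto_neg_atBot_atTop).congr fun x => by simp,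
    (hQ.comp tendsto_neg_atBot_atTop).congr fun x => by simp⟩

end IsSol

end Asymptotics

section Derivatives

open Asymptotics

variable {E : Type*} [NormedAddCommGroup E] [NormedSpace ℝ E]

theorem norm_smul_deriv_le_of_hasDerivAt {f f' f'' : ℝ → E} {x h M : ℝ} (hh : 0 ≤ h)
    (hd : ∀ y, HasDerivAt f (f' y) y) (hd' : ∀ y, HasDerivAt f' (f'' y) y)
    (hM : ∀ y ≥ x, ‖f'' y‖ ≤ M) : ‖h • f' x‖ ≤ ‖f (x + h) - f x‖ + M * h * h := by
  have hle (y : ℝ) (hy : y ∈ Icc x (x + h)) : ‖f' y - f' x‖ ≤ M * h := by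
    refine (norm_image_sub_le_of_norm_deriv_le_segment' (fun z _ => (hd' z).hasDerivWithinAt)
      (fun z hz => hM z hz.1) y hy).trans ?_
    have : 0 ≤ M := (norm_nonneg _).trans (hM x le_rfl)
    gcongr
    linarith [hy.2]
  have hrem := norm_image_sub_le_of_norm_deriv_le_segment'
    (fun y _ => ((hd y).fun_sub ((hasDerivAt_id' y).smul_const (f' x))).hasDerivWithinAt)
    (fun y hy => by rw [one_smul]; exact hle y (Ico_subset_Icc_self hy)) (x + h)
    (right_mem_Icc.mpr (by linarith))
  calc ‖h • f' x‖
      = ‖(f (x + h) - f x) - (f (x + h) - (x + h) • f' x - (f x - x • f' x))‖ := by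
        congr 1; module
    _ ≤ _ := (norm_sub_le _ _).trans (by gcongr; simpa using hrem)

theorem tendsto_deriv_zero_of_isBigO {f f' f'' : ℝ → E} {l : E}
    (hd : ∀ x, HasDerivAt f (f' x) x) (hd' : ∀ x, HasDerivAt f' (f'' x) x)
    (hf : Tendsto f atTop (𝓝 l)) (hO : f'' =O[atTop] fun _ => (1 : ℝ)) :
    Tendsto f' atTop (𝓝 0) := by
  obtain ⟨M, hM⟩ := hO.bound
  obtain ⟨X, hX⟩ := eventually_atTop.mp hM
  simp only [norm_one, mul_one] at hX
  have hM0 : 0 ≤ M := (norm_nonneg _).trans (hX X le_rfl)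
  rw [NormedAddGroup.tendsto_nhds_zero]
  intro ε hε
  set h : ℝ := ε / (2 * (M + 1)) with hh
  have hh0 : 0 < h := by positivity
  have hMh : M * h ≤ ε / 2 := by
    rw [hh, mul_div_assoc', div_le_div_iff₀ (by positivity) two_pos]
    nlinarith
  have hincr : Tendsto (fun x => f (x + h) - f x) atTop (𝓝 0) := by
    simpa using (hf.comp (tendsto_atTop_add_const_right _ h tendsto_id)).sub hf
  have hsmall := NormedAddGroup.tendsto_nhds_zero.mp hincr (h * (ε / 2)) (by positivity)
  filter_upwards [hsmall, eventually_ge_atTop X] with x hx hxX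
  have hle := norm_smul_deriv_le_of_hasDerivAt hh0.le hd hd' fun y hy => hX y (hxX.trans hy)
  rw [norm_smul, Real.norm_of_nonneg hh0.le] at hle
  refine lt_of_mul_lt_mul_left ?_ hh0.le
  nlinarith

theorem hasDerivAt_iteratedDeriv {f : ℝ → E} (hf : ContDiff ℝ ∞ f) (j : ℕ) (x : ℝ) :
    HasDerivAt (iteratedDeriv j f) (iteratedDeriv (j + 1) f x) x := by
  rw [iteratedDeriv_succ]
  exact (hf.differentiable_iteratedDeriv j (by exact_mod_cast WithTop.coe_lt_top j) x).hasDerivAt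

theorem hasDerivAt_exp_mul_smul {f : ℝ → E} {f' : E} {x : ℝ} (s : ℝ) (hf : HasDerivAt f f' x) :
    HasDerivAt (fun x => Real.exp (s * x) • f x) (Real.exp (s * x) • (s • f x + f')) x := by
  have he : HasDerivAt (fun x => Real.exp (s * x)) (Real.exp (s * x) * s) x := by
    simpa using ((hasDerivAt_id' x).const_mul s).exp
  refine (he.smul hf).congr_deriv ?_
  module

variable {Ψ : ℝ → E} {s : ℝ} {v : E}

theorem tendsto_exp_smul_iteratedDeriv_atTop (hΨ : ContDiff ℝ ∞ Ψ)
    (hO : ∀ j, iteratedDeriv j Ψ =O[⊤] Ψ)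
    (h : Tendsto (fun x => Real.exp (s * x) • Ψ x) atTop (𝓝 v)) (j : ℕ) :
    Tendsto (fun x => Real.exp (s * x) • iteratedDeriv j Ψ x) atTop (𝓝 ((-s) ^ j • v)) := by
  have hbdd (i : ℕ) : (fun x => Real.exp (s * x) • iteratedDeriv i Ψ x) =O[atTop]
      fun _ => (1 : ℝ) :=
    ((isBigO_refl (fun x => Real.exp (s * x)) atTop).smul ((hO i).mono le_top)).trans
      (h.isBigO_one ℝ)
  induction j with
  | zero => simpa using h
  | succ j ih =>
    have hd := fun i x => hasDerivAt_iteratedDeriv hΨ i x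
    have hlim : Tendsto (fun x => Real.exp (s * x) •
        (s • iteratedDeriv j Ψ x + iteratedDeriv (j + 1) Ψ x)) atTop (𝓝 0) := by
      refine tendsto_deriv_zero_of_isBigO (fun x => hasDerivAt_exp_mul_smul s (hd j x))
        (fun x => hasDerivAt_exp_mul_smul s (((hd j x).fun_const_smul s).fun_add (hd (j + 1) x)))
        ih ?_
      refine ((((hbdd j).const_smul_left (s ^ 2)).add
        ((hbdd (j + 1)).const_smul_left (2 * s))).add (hbdd (j + 2))).congr_left fun x => ?_
      simp only [Pi.smul_apply]
      module
    have hsub := hlim.sub (ih.const_smul s)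
    rw [zero_sub, ← neg_smul, smul_smul, ← pow_succ'] at hsub
    refine hsub.congr fun x => ?_
    module

theorem tendsto_exp_smul_iteratedDeriv_atBot (hΨ : ContDiff ℝ ∞ Ψ)
    (hO : ∀ j, iteratedDeriv j Ψ =O[⊤] Ψ)
    (h : Tendsto (fun x => Real.exp (s * x) • Ψ x) atBot (𝓝 v)) (j : ℕ) :
    Tendsto (fun x => Real.exp (s * x) • iteratedDeriv j Ψ x) atBot (𝓝 ((-s) ^ j • v)) := by
  have hO' (i : ℕ) : iteratedDeriv i (fun x => Ψ (-x)) =O[⊤] fun x => Ψ (-x) := by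
    rw [funext (iteratedDeriv_comp_neg i Ψ)]
    exact ((hO i).comp_tendsto tendsto_top).const_smul_left _
  have hlim := tendsto_exp_smul_iteratedDeriv_atTop (Ψ := fun x => Ψ (-x)) (s := -s)
    (hΨ.comp contDiff_neg) hO'
    ((h.comp tendsto_neg_atTop_atBot).congr fun x => by simp) j
  have hlim' := (hlim.comp tendsto_neg_atBot_atTop).const_smul ((-1 : ℝ) ^ j)
  rw [smul_smul, ← mul_pow, neg_one_mul, neg_neg] at hlim'
  refine hlim'.congr fun x => ?_
  rw [Function.comp_apply, iteratedDeriv_comp_neg, smul_comm, smul_smul ((-1) ^ j),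
    ← mul_pow]
  simp

section LinearSystem

variable {A : ℝ → E →L[ℝ] E}

theorem contDiff_of_hasDerivAt_clm_apply (hA : ContDiff ℝ ∞ A)
    (h : ∀ x, HasDerivAt Ψ (A x (Ψ x)) x) : ContDiff ℝ ∞ Ψ := by
  refine contDiff_infty.mpr fun n => ?_
  induction n with
  | zero => exact contDiff_zero.mpr (continuous_iff_continuousAt.mpr fun x => (h x).continuousAt)
  | succ n ih =>
    rw [Nat.cast_succ, contDiff_succ_iff_deriv]
    refine ⟨fun x => (h x).differentiableAt, by simp, ?_⟩
    rw [funext fun x => (h x).deriv]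
    exact (contDiff_infty.mp hA n).clm_apply ih

theorem isBigO_iteratedDeriv_of_hasDerivAt_clm_apply (hA : ContDiff ℝ ∞ A)
    (hAb : ∀ j, iteratedDeriv j A =O[⊤] fun _ => (1 : ℝ))
    (h : ∀ x, HasDerivAt Ψ (A x (Ψ x)) x) (j : ℕ) : iteratedDeriv j Ψ =O[⊤] Ψ := by
  have hΨ := contDiff_of_hasDerivAt_clm_apply hA h
  induction j using Nat.strong_induction_on with
  | _ j ih =>
    rcases j with - | j
    · rw [iteratedDeriv_zero]
    have hleibniz (x : ℝ) : ‖iteratedDeriv (j + 1) Ψ x‖ ≤ ∑ i ∈ Finset.range (j + 1),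
        j.choose i * ‖iteratedDeriv i A x‖ * ‖iteratedDeriv (j - i) Ψ x‖ := by
      rw [iteratedDeriv_succ', funext fun x => (h x).deriv]
      simp only [← norm_iteratedFDeriv_eq_norm_iteratedDeriv]
      exact norm_iteratedFDeriv_clm_apply hA hΨ x (by exact_mod_cast le_top)
    refine (IsBigO.of_norm_le (g := fun x => ∑ i ∈ Finset.range (j + 1),
      j.choose i * ‖iteratedDeriv i A x‖ * ‖iteratedDeriv (j - i) Ψ x‖) hleibniz).trans ?_
    refine IsBigO.fun_sum fun i _ => ?_
    have hmul := ((hAb i).norm_left.const_mul_left (j.choose i : ℝ)).mul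
      (ih (j - i) (by omega)).norm_norm
    simp only [one_mul] at hmul
    exact hmul.of_norm_right

end LinearSystem

end Derivatives

section Eigenfunctions

open Asymptotics

section ExponentialWeight

variable {E : Type*} [NormedAddCommGroup E] {f : ℝ → E}

theorem isBigO_norm_sq_of_tendsto_exp_smul [NormedSpace ℝ E] {s : ℝ} {l : Filter ℝ} {v : E}
    (h : Tendsto (fun x => Real.exp (s * x) • f x) l (𝓝 v)) :
    (fun x => ‖f x‖ ^ 2) =O[l] fun x => Real.exp (-(2 * s) * x) := by
  have hO : f =O[l] fun x => Real.exp (-(s * x)) := by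
    refine ((isBigO_refl (fun x => Real.exp (-(s * x))) l).smul (h.isBigO_one ℝ)).congr
      (fun x => ?_) fun x => by simp
    rw [smul_smul, ← Real.exp_add, neg_add_cancel, Real.exp_zero, one_smul]
  refine (hO.norm_left.pow 2).congr_right fun x => ?_
  rw [← Real.exp_nat_mul]
  congr 1
  push_cast
  ring

theorem memLp_two_of_tendsto_exp_smul [NormedSpace ℝ E] (hf : Continuous f) {sp sm : ℝ} {vp vm : E}
    (hsp : 0 < sp) (hsm : sm < 0) (hp : Tendsto (fun x => Real.exp (sp * x) • f x) atTop (𝓝 vp))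
    (hm : Tendsto (fun x => Real.exp (sm * x) • f x) atBot (𝓝 vm)) : MemLp f 2 := by
  rw [memLp_two_iff_integrable_sq_norm hf.aestronglyMeasurable]
  exact (hf.norm.pow 2).locallyIntegrable.integrable_of_isBigO_atBot_atTop
    (isBigO_norm_sq_of_tendsto_exp_smul hm)
    ⟨Iic 0, Iic_mem_atBot 0, integrableOn_exp_mul_Iic (by linarith) 0⟩
    (isBigO_norm_sq_of_tendsto_exp_smul hp)
    ⟨Ioi 0, Ioi_mem_atTop 0, integrableOn_exp_mul_Ioi (by linarith) 0⟩

end ExponentialWeight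

theorem memSobolev_of_memLp_iteratedDeriv {Ψ : ℝ → Spinor} (hΨ : ContDiff ℝ ∞ Ψ)
    (hL2 : ∀ j, MemLp (iteratedDeriv j Ψ) 2) {u : L2} (hu : u =ᵐ[volume] Ψ) (s : ℕ) :
    TemperedDistribution.MemSobolev (s : ℝ) 2 (toDist u) := by
  have hu0 : u = (hL2 0).toLp _ := by
    refine Lp.ext ?_
    filter_upwards [hu, (hL2 0).coeFn_toLp] with x hx hx'
    rw [hx, hx', iteratedDeriv_zero]
  rw [hu0]
  refine memSobolev_of_hasL2Deriv (D := fun j => (hL2 j).toLp _) (fun j => ?_) s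
  refine hasL2Deriv_of_isPrimitive (IsPrimitive.congr (.of_hasDerivAt ?_
    (hasDerivAt_iteratedDeriv hΨ j)) (hL2 (j + 1)).coeFn_toLp.symm) (hL2 j).coeFn_toLp
  exact hΨ.continuous_iteratedDeriv _ (by exact_mod_cast le_top)

namespace HasExpDecay

variable {e : Fin 2 → ℂ} {Ψ : ℝ → Spinor}

theorem memLp (h : HasExpDecay e Ψ) (hΨ : Continuous Ψ) : MemLp Ψ 2 := by
  obtain ⟨sm, sp, hsm, hsp, _, _, _, _, hp, hm⟩ := h
  exact memLp_two_of_tendsto_exp_smul hΨ hsp hsm hp hm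

theorem hasExpDecay_iteratedDeriv (h : HasExpDecay e Ψ) (hΨ : ContDiff ℝ ∞ Ψ)
    (hO : ∀ j, iteratedDeriv j Ψ =O[⊤] Ψ) (j : ℕ) : HasExpDecay e (iteratedDeriv j Ψ) := by
  obtain ⟨sm, sp, hsm, hsp, qm, qp, hqm, hqp, hp, hm⟩ := h
  have hsmul (s : ℝ) (q : Fin 2 → ℝ) : s • (WithLp.toLp 2 fun i => e i * (q i : ℂ) : Spinor) =
      WithLp.toLp 2 fun i => e i * ((s • q) i : ℂ) := by
    ext i
    simp [mul_left_comm]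
  refine ⟨sm, sp, hsm, hsp, (-sm) ^ j • qm, (-sp) ^ j • qp,
    smul_ne_zero (pow_ne_zero j (neg_ne_zero.mpr hsm.ne)) hqm,
    smul_ne_zero (pow_ne_zero j (neg_ne_zero.mpr hsp.ne')) hqp, ?_, ?_⟩
  · rw [← hsmul]
    exact tendsto_exp_smul_iteratedDeriv_atTop hΨ hO hp j
  · rw [← hsmul]
    exact tendsto_exp_smul_iteratedDeriv_atBot hΨ hO hm j

end HasExpDecay

namespace IsCbInfty

variable {κ : ℝ → ℝ} {F : Type*} [NormedAddCommGroup F] [NormedSpace ℝ F]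

theorem contDiff_smul_add (hκ : IsCbInfty κ) (S T : F) : ContDiff ℝ ∞ fun x => κ x • S + T :=
  (hκ.1.smul contDiff_const).add contDiff_const

theorem isBigO_iteratedDeriv_smul_add (hκ : IsCbInfty κ) (S T : F) (j : ℕ) :
    iteratedDeriv j (fun x => κ x • S + T) =O[⊤] fun _ => (1 : ℝ) := by
  have hconst (v : F) : (fun _ : ℝ => v) =O[⊤] fun _ => (1 : ℝ) :=
    isBigO_const_const v one_ne_zero ⊤
  have hderiv (i : ℕ) : iteratedDeriv i κ =O[⊤] fun _ => (1 : ℝ) := by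
    obtain ⟨C, hC⟩ := hκ.2 i
    exact isBigO_top.mpr ⟨C, fun x => by simpa using hC x⟩
  have hsmul (i : ℕ) : (fun x => iteratedDeriv i κ x • S) =O[⊤] fun _ => (1 : ℝ) := by
    simpa using (hderiv i).smul (hconst S)
  rcases Nat.eq_zero_or_pos j with rfl | hj
  · rw [iteratedDeriv_zero]
    simpa using (hsmul 0).add (hconst T)
  · simp only [add_comm _ T]
    refine (hsmul j).congr_left fun x => ?_
    rw [iteratedDeriv_const_add hj]
    exact (iteratedDeriv_smul_const (hκ.1.contDiffAt.of_le (by exact_mod_cast le_top)) S).symm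

end IsCbInfty

namespace IsSol

variable {κ : ℝ → ℝ} {L : ℝ}

theorem hasDerivAt_spinor {b c : ℂ} {P Q : ℝ → ℂ} (h : IsSol κ b c P Q) (x : ℝ) :
    HasDerivAt (spinor P Q) (spinor (fun x => κ x * P x + b * Q x)
      (fun x => c * P x - κ x * Q x) x) x := by
  refine (PiLp.continuousLinearEquiv 2 ℝ fun _ : Fin 2 => ℂ).symm.hasFDerivAt.comp_hasDerivAt x
    (hasDerivAt_pi.mpr fun i => ?_)
  fin_cases i
  · exact h.fst x
  · exact h.snd x

theorem exists_hasDerivAt_clm_apply {b c : ℂ} {P Q : ℝ → ℂ} (h : IsSol κ b c P Q) :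
    ∃ S T : Spinor →L[ℝ] Spinor, ∀ x, HasDerivAt (spinor P Q)
      ((κ x • S + T) (spinor P Q x)) x := by
  let clm (M : Matrix (Fin 2) (Fin 2) ℂ) : Spinor →L[ℝ] Spinor :=
    M.toEuclideanLin.toContinuousLinearMap.restrictScalars ℝ
  refine ⟨clm !![1, 0; 0, -1], clm !![0, b; c, 0],
    fun x => (h.hasDerivAt_spinor x).congr_deriv ?_⟩
  ext i
  fin_cases i <;> simp [clm, spinor, Matrix.toLpLin_apply, Matrix.vecHead, Matrix.vecTail] <;> ring

theorem eigenfunctionDecay {b c : ℂ} {P Q : ℝ → ℂ} (h : IsSol κ b c P Q) {e : Fin 2 → ℂ} {t : ℂ}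
    (ht : t ≠ 0) (hdecay : HasExpDecay (fun i => t * e i) (spinor P Q)) {u : L2}
    (hu : u =ᵐ[volume] spinor P Q) : EigenfunctionDecay κ e u := by
  obtain ⟨S, T, hST⟩ := h.exists_hasDerivAt_clm_apply
  refine ⟨spinor P Q, t, continuous_iff_continuousAt.mpr fun x => (hST x).continuousAt, hu, ht,
    hdecay, fun hκ => ?_⟩
  have hA := hκ.contDiff_smul_add S T
  have hΨ := contDiff_of_hasDerivAt_clm_apply hA hST
  have hderiv := hdecay.hasExpDecay_iteratedDeriv hΨ
    (isBigO_iteratedDeriv_of_hasDerivAt_clm_apply hA (hκ.isBigO_iteratedDeriv_smul_add S T) hST)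
  exact ⟨hΨ, hderiv, memSobolev_of_memLp_iteratedDeriv hΨ (fun j => (hderiv j).memLp
    (hΨ.continuous_iteratedDeriv j (by exact_mod_cast le_top))) hu⟩

theorem hasExpDecay {κp κm b c : ℝ} {p q : ℝ → ℝ} (h : IsSol κ b c p q) (hL : ∀ x, |κ x| ≤ L)
    (hp : Tendsto κ atTop (𝓝 κp)) (hm : Tendsto κ atBot (𝓝 κm))
    (hip : IntegrableOn (fun x => κ x - κp) (Ioi 0))
    (him : IntegrableOn (fun x => κ x - κm) (Iio 0)) (hκp : 0 < κp ^ 2 + b * c)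
    (hκm : 0 < κm ^ 2 + b * c) (hpL2 : MemLp p 2) (hqL2 : MemLp q 2) (h0 : p 0 ≠ 0 ∨ q 0 ≠ 0)
    (e : Fin 2 → ℂ) : HasExpDecay e (spinor (fun x => e 0 * p x) (fun x => e 1 * q x)) := by
  obtain ⟨sp, hsp, Pp, Qp, hqp, hPp, hQp⟩ :=
    h.exists_tendsto_exp_mul_atTop hL hp hip hκp hpL2 hqL2 h0
  obtain ⟨sm, hsm, Pm, Qm, hqm, hPm, hQm⟩ :=
    h.exists_tendsto_exp_mul_atBot hL hm him hκm hpL2 hqL2 h0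
  have hvec {P Q : ℝ} (hne : P ≠ 0 ∨ Q ≠ 0) : ![P, Q] ≠ 0 := by
    simpa [imp_iff_not_or] using hne
  have hlim {s P Q : ℝ} {l : Filter ℝ} (hP : Tendsto (fun x => Real.exp (s * x) * p x) l (𝓝 P))
      (hQ : Tendsto (fun x => Real.exp (s * x) * q x) l (𝓝 Q)) :
      Tendsto (fun x => Real.exp (s * x) • spinor (fun x => e 0 * p x) (fun x => e 1 * q x) x) l
        (𝓝 (WithLp.toLp 2 fun i => e i * ((![P, Q] i : ℝ) : ℂ))) := by
    refine ((PiLp.continuous_toLp 2 _).tendsto _).comp (tendsto_pi_nhds.mpr fun i => ?_)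
    fin_cases i
    · exact (((Complex.continuous_ofReal.tendsto P).comp hP).const_mul (e 0)).congr fun x => by
        simp [spinor, mul_left_comm]
    · exact (((Complex.continuous_ofReal.tendsto Q).comp hQ).const_mul (e 1)).congr fun x => by
        simp [spinor, mul_left_comm]
  exact ⟨sm, sp, hsm, hsp, _, _, hvec hqm, hvec hqp, hlim hPp hQp, hlim hPm hQm⟩

theorem const_mul {𝕜 : Type*} [RCLike 𝕜] {b c b' c' r s : 𝕜} {p q : ℝ → 𝕜} (h : IsSol κ b c p q)
    (hb : r * b = b' * s) (hc : s * c = c' * r) :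
    IsSol κ b' c' (fun x => r * p x) (fun x => s * q x) where
  fst x := ((h.fst x).const_mul r).congr_deriv (by
    rw [mul_add, ← mul_assoc r b, hb, mul_smul_comm, mul_assoc])
  snd x := ((h.snd x).const_mul s).congr_deriv (by
    rw [mul_sub, ← mul_assoc s c, hc, mul_smul_comm, mul_assoc])

end IsSol

section Decay

variable {κ : ℝ → ℝ} {κp κm : ℝ}

theorem eigenfunctionDecay_of_mem_diracGraph (hκ : Continuous κ) (hp : Tendsto κ atTop (𝓝 κp))
    (hm : Tendsto κ atBot (𝓝 κm)) (hip : IntegrableOn (fun x => κ x - κp) (Ioi 0))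
    (him : IntegrableOn (fun x => κ x - κm) (Iio 0)) {E : ℝ} (hEp : |E| < 3 / 2 * |κp|)
    (hEm : |E| < 3 / 2 * |κm|) {e : Fin 2 → ℂ} (he : ∀ i, e i ≠ 0)
    (hphase : E = 0 ∨ e 0 = Complex.I * e 1) {u : L2} (hu0 : u ≠ 0)
    (hu : (u, (E : ℂ) • u) ∈ diracGraph κ) : EigenfunctionDecay κ e u := by
  obtain ⟨L, hL⟩ := exists_abs_le_of_tendsto hκ hp hm
  obtain ⟨P, Q, hPQ, hP, hQ, h⟩ := exists_isSol_of_mem_diracGraph hκ hu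
  have hphase' : (E : ℂ) * e 0 = E * (Complex.I * e 1) :=
    hphase.elim (fun hE => by simp [hE]) fun he => by rw [he]
  have hreal : IsSol κ ((2 / 3 * E : ℝ) : ℂ) (-(2 / 3 * E) : ℝ) (fun x => (e 0)⁻¹ * P x)
      (fun x => (e 1)⁻¹ * Q x) := by
    have h0 := he 0
    have h1 := he 1
    refine h.const_mul ?_ ?_ <;> push_cast <;> field_simp
    · linear_combination -hphase'
    · linear_combination Complex.I * hphase' + E * e 1 * Complex.I_sq
  have hpos {k : ℝ} (hk : |E| < 3 / 2 * |k|) : 0 < k ^ 2 + 2 / 3 * E * -(2 / 3 * E) := by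
    have := sq_lt_sq.mpr (show |2 / 3 * E| < |k| by
      rw [abs_mul, abs_of_pos (by norm_num : (0 : ℝ) < 2 / 3)]
      linarith)
    linarith
  have hne := (h.zero_ne_of_ae_eq hL hPQ hu0).imp (mul_ne_zero (inv_ne_zero (he 0)))
    (mul_ne_zero (inv_ne_zero (he 1)))
  obtain ⟨p, q, t, hpq, hpq0, hpL2, hqL2, ht, heq⟩ :=
    hreal.exists_real_of_memLp hL (hP.const_mul _) (hQ.const_mul _) hne
  refine h.eigenfunctionDecay ht ?_ hPQ
  convert hpq.hasExpDecay hL hp hm hip him (hpos hEp) (hpos hEm) hpL2 hqL2 hpq0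
    (fun i => t * e i) using 2
  · ext x
    rw [mul_right_comm, ← (heq x).1, mul_right_comm, inv_mul_cancel₀ (he 0), one_mul]
  · ext x
    rw [mul_right_comm, ← (heq x).2, mul_right_comm, inv_mul_cancel₀ (he 1), one_mul]

end Decay

section ZeroMode

variable {κ : ℝ → ℝ} {κp κm L : ℝ}

theorem isEigenvalue_of_isSol (hκ : Continuous κ) (hL : ∀ x, |κ x| ≤ L) {z : ℂ} {p q : ℝ → ℂ}
    (h : IsSol κ (2 / 3 * Complex.I * z) (2 / 3 * Complex.I * z) p q) (hp : MemLp p 2)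
    (hq : MemLp q 2) (h0 : p 0 ≠ 0 ∨ q 0 ≠ 0) : IsEigenvalue (dirac κ) z := by
  have hpq := memLp_spinor hp hq
  have hpc := h.continuous_fst
  have hqc := h.continuous_snd
  let u : L2 := hpq.toLp _
  have hmem : (u, z • u) ∈ diracGraph κ := by
    refine mem_diracGraph_of_isPrimitive hκ hL (IsPrimitive.congr (.of_hasDerivAt ?_
      h.hasDerivAt_spinor) ?_) hpq.coeFn_toLp
    · exact continuous_spinor (by fun_prop) (by fun_prop)
    · filter_upwards [Lp.coeFn_smul z u, hpq.coeFn_toLp] with x hx hx'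
      rw [hx, Pi.smul_apply, hx']
      ext i
      fin_cases i <;> simp [spinor, derivSymbol] <;> ring
  rw [← dirac_graph, LinearPMap.mem_graph_iff] at hmem
  obtain ⟨y, hy, hyz⟩ := hmem
  refine ⟨y, fun hy0 => ?_, hyz.trans (by rw [hy])⟩
  have hae : spinor p q =ᵐ[volume] 0 := hpq.coeFn_toLp.symm.trans
    (Lp.eq_zero_iff_ae_eq_zero.mp (hy.symm.trans (congrArg Subtype.val hy0)))
  have hzero := congrFun ((Continuous.ae_eq_iff_eq volume (continuous_spinor hpc hqc)
    continuous_const).mp hae) 0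
  exact h0.elim (fun hp0 => hp0 (congrArg (· 0) hzero)) fun hq0 => hq0 (congrArg (· 1) hzero)

/-- The function `exp (∫₀ˣ κ)`, which spans the solutions of `p' = κ p`; it or its inverse is a
component of the zero mode of the Dirac operator. -/
def expPrimitive (κ : ℝ → ℝ) (x : ℝ) : ℝ := Real.exp (∫ t in (0 : ℝ)..x, κ t)

theorem hasDerivAt_expPrimitive (hκ : Continuous κ) (x : ℝ) :
    HasDerivAt (expPrimitive κ) (κ x * expPrimitive κ x) x := by
  rw [mul_comm]
  exact (hκ.integral_hasStrictDerivAt 0 x).hasDerivAt.exp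

theorem isSol_expPrimitive (hκ : Continuous κ) : IsSol κ 0 0 (expPrimitive κ) 0 where
  fst x := (hasDerivAt_expPrimitive hκ x).congr_deriv (by simp)
  snd x := (hasDerivAt_const x 0).congr_deriv (by simp)

theorem exp_mul_expPrimitive (hκ : Continuous κ) (k x : ℝ) :
    Real.exp (-k * x) * expPrimitive κ x = Real.exp (∫ t in (0 : ℝ)..x, (κ t - k)) := by
  rw [expPrimitive, ← Real.exp_add, intervalIntegral.integral_sub (hκ.intervalIntegrable _ _)
    intervalIntegrable_const, intervalIntegral.integral_const, smul_eq_mul]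
  ring_nf

theorem memLp_expPrimitive (hκ : Continuous κ) (hκp : κp < 0) (hκm : 0 < κm)
    (hip : IntegrableOn (fun x => κ x - κp) (Ioi 0))
    (him : IntegrableOn (fun x => κ x - κm) (Iio 0)) : MemLp (expPrimitive κ) 2 := by
  have hc : Continuous (expPrimitive κ) :=
    continuous_iff_continuousAt.mpr fun x => (hasDerivAt_expPrimitive hκ x).continuousAt
  have htop := intervalIntegral_tendsto_integral_Ioi 0 hip tendsto_id
  have him' : IntegrableOn (fun x => κ x - κm) (Iic 0) :=
    Iff.mpr integrableOn_Iic_iff_integrableOn_Iio him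
  have hbot := (intervalIntegral_tendsto_integral_Iic 0 him' tendsto_id).neg
  refine memLp_two_of_tendsto_exp_smul hc (neg_pos.mpr hκp) (neg_lt_zero.mpr hκm)
    ((Real.continuous_exp.tendsto _).comp htop |>.congr fun x => ?_)
    ((Real.continuous_exp.tendsto _).comp hbot |>.congr fun x => ?_)
  · rw [smul_eq_mul, exp_mul_expPrimitive hκ]
    rfl
  · rw [smul_eq_mul, exp_mul_expPrimitive hκ, Function.comp_apply,
      ← intervalIntegral.integral_symm]
    rfl

theorem exists_isSol_memLp (hκ : Continuous κ) (hsign : κp * κm < 0)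
    (hip : IntegrableOn (fun x => κ x - κp) (Ioi 0))
    (him : IntegrableOn (fun x => κ x - κm) (Iio 0)) :
    ∃ p q : ℝ → ℝ, IsSol κ 0 0 p q ∧ MemLp p 2 ∧ MemLp q 2 ∧ (p 0 ≠ 0 ∨ q 0 ≠ 0) := by
  rcases mul_neg_iff.mp hsign with ⟨hκp, hκm⟩ | ⟨hκp, hκm⟩
  · have hswap := (isSol_expPrimitive (κ := fun x => -κ x) hκ.neg).swap
    simp only [neg_neg] at hswap
    refine ⟨_, _, hswap, MemLp.zero, memLp_expPrimitive (κp := -κp) (κm := -κm) hκ.neg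
      (by linarith) (by linarith) ?_ ?_, .inr (Real.exp_ne_zero _)⟩
    · simpa only [neg_sub_neg, neg_sub, Pi.neg_def] using hip.neg
    · simpa only [neg_sub_neg, neg_sub, Pi.neg_def] using him.neg
  · exact ⟨_, _, isSol_expPrimitive hκ, memLp_expPrimitive hκ hκp hκm hip him, MemLp.zero,
      .inl (Real.exp_ne_zero _)⟩

theorem isEigenvalue_dirac_zero (hκ : Continuous κ) (hL : ∀ x, |κ x| ≤ L) (hsign : κp * κm < 0)
    (hip : IntegrableOn (fun x => κ x - κp) (Ioi 0))
    (him : IntegrableOn (fun x => κ x - κm) (Iio 0)) : IsEigenvalue (dirac κ) 0 := by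
  obtain ⟨p, q, h, hp, hq, h0⟩ := exists_isSol_memLp hκ hsign hip him
  exact isEigenvalue_of_isSol hκ hL (by simpa using h.ofReal) hp.ofReal hq.ofReal
    (by simpa using h0)

end ZeroMode

end Eigenfunctions

section Phases

theorem realPhases_ne_zero (i : Fin 2) : realPhases i ≠ 0 := by
  fin_cases i <;> exact Complex.exp_ne_zero _

theorem realPhases_zero_eq : realPhases 0 = Complex.I * realPhases 1 := by
  change Complex.exp (Complex.I * (Real.pi / 4)) =
    Complex.I * Complex.exp (-(Complex.I * (Real.pi / 4)))
  nth_rw 2 [← Complex.exp_pi_div_two_mul_I]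
  rw [← Complex.exp_add]
  ring_nf

end Phases

end DiracDomainWall

end

theorem lemma4p2 (κ : ℝ → ℝ) (κp κm : ℝ) (hκ : Continuous κ)
    (hp : Tendsto κ atTop (𝓝 κp)) (hm : Tendsto κ atBot (𝓝 κm)) (hsign : κp * κm < 0)
    (hip : IntegrableOn (fun x => κ x - κp) (Ici 0))
    (him : IntegrableOn (fun x => κ x - κm) (Iic 0))
    (a : ℝ) (ha : a = 3 / 2 * min |κp| |κm|) :
    DiracDomainWall.essentialSpectrum (DiracDomainWall.dirac κ) =
        Complex.ofReal '' (Iic (-a) ∪ Ici a) ∧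
    (DiracDomainWall.IsSimpleEigenvalue (DiracDomainWall.dirac κ) 0 ∧
      ∀ u : (DiracDomainWall.dirac κ).domain, u ≠ 0 → DiracDomainWall.dirac κ u = 0 →
        DiracDomainWall.EigenfunctionDecay κ (fun _ => 1) u) ∧
    (∀ E ∈ Ioo (-a) a, DiracDomainWall.IsEigenvalue (DiracDomainWall.dirac κ) (E : ℂ) →
      DiracDomainWall.IsSimpleEigenvalue (DiracDomainWall.dirac κ) (E : ℂ) ∧
      ∀ u : (DiracDomainWall.dirac κ).domain, u ≠ 0 →
        DiracDomainWall.dirac κ u = (E : ℂ) • (u : DiracDomainWall.L2) →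
        DiracDomainWall.EigenfunctionDecay κ DiracDomainWall.realPhases u) := by
  obtain ⟨L, hL⟩ := DiracDomainWall.exists_abs_le_of_tendsto hκ hp hm
  have hipo := hip.mono_set Ioi_subset_Ici_self
  have himo := him.mono_set Iio_subset_Iic_self
  have hp0 : (0 : ℝ) < 3 / 2 * |κp| := by
    have := left_ne_zero_of_mul hsign.ne
    positivity
  have hm0 : (0 : ℝ) < 3 / 2 * |κm| := by
    have := right_ne_zero_of_mul hsign.ne
    positivity
  refine ⟨ha ▸ DiracDomainWall.essentialSpectrum_dirac hκ hp hm,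
    ⟨DiracDomainWall.isSimpleEigenvalue_of_isEigenvalue hκ hL
      (DiracDomainWall.isEigenvalue_dirac_zero hκ hL hsign hipo himo), fun u hu0 hu => ?_⟩,
    fun E hE hev => ⟨DiracDomainWall.isSimpleEigenvalue_of_isEigenvalue hκ hL hev,
      fun u hu0 hu => ?_⟩⟩
  · exact DiracDomainWall.eigenfunctionDecay_of_mem_diracGraph hκ hp hm hipo himo (E := 0)
      (by rwa [abs_zero]) (by rwa [abs_zero]) (fun _ => one_ne_zero) (.inl rfl) (by simpa using hu0)
      (DiracDomainWall.dirac_apply_eq_iff.mp (by simpa using hu))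
  · have hEa : |E| < 3 / 2 * min |κp| |κm| := ha ▸ abs_lt.mpr hE
    exact DiracDomainWall.eigenfunctionDecay_of_mem_diracGraph hκ hp hm hipo himo
      (hEa.trans_le (by gcongr; exact min_le_left _ _))
      (hEa.trans_le (by gcongr; exact min_le_right _ _)) DiracDomainWall.realPhases_ne_zero
      (.inr DiracDomainWall.realPhases_zero_eq) (by simpa using hu0)
      (DiracDomainWall.dirac_apply_eq_iff.mp hu)
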